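/- Let $p$ be a prime and let $F$ be a function field of one variable with constant field $\mathbb{F}$, where $\mathbb{F}$ is an algebraic extension of $\mathbb{F}_p$ (finite or infinite) that is algebraically closed in $F$. Let $E/F$ be an elliptic curve which is non-isotrivial ($j(E)\notin\mathbb{F}$) and which has good or split multiplicative reduction at every place of $F$. Let $l\neq p$ be a prime, let $\mathcal{F}/F$ be a $\mathbb{Z}_l^d$-extension, and let $F_0\subseteq F_1\subseteq\dots\subseteq F_n\subseteq\cdots$ be finite extensions of $F$ with $\bigcup_n F_n=\mathcal{F}$; put $\Gamma_n=\mathrm{Gal}(\mathcal{F}/F_n)$. Let $r$ be a prime different from $l$ and $p$. For an algebraic extension $L/F$ contained in $\mathcal F$, let $$Sel_E(L)_r=\mathrm{Ker}\Big\{H^1(L,E[r^\infty])\longrightarrow\prod_{v}H^1(L_v,E[r^\infty])/\mathrm{Im}\,\kappa_v\Big\},$$ where $H^1(K,\cdot)$ is the continuous cohomology of $\mathrm{Gal}(K^{sep}/K)$, $v$ runs over all places of $L$, $L_v$ is the completion of $L$ at $v$, and $\kappa_v\colon E(L_v)\otimes\mathbb{Q}_r/\mathbb{Z}_r\to H^1(L_v,E[r^\infty])$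 is the Kummer map, which sends $P\otimes r^{-k}$ to the class of $\sigma\mapsto\sigma(Q)-Q$ for any $Q\in E(L_v^{sep})$ with $r^kQ=P$. Then for every $n$ the natural restriction map $$Sel_E(F_n)_r\longrightarrow Sel_E(\mathcal{F})_r^{\Gamma_n}$$ is well defined and an isomorphism. -/

import Mathlib

noncomputable section

namespace SelmerControl

universe u

/-! ### Continuous cohomology in degree one, with discrete coefficients -/

section Cohomology

variable (G M : Type*) [Group G] [TopologicalSpace G] [AddCommGroup M] [DistribMulAction G M]

/-- Continuous `1`-cocycles of `G` with values in the discrete module `M`. -/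
def Z1 : AddSubgroup (G → M) where
  carrier := {c | IsLocallyConstant c ∧ ∀ σ τ : G, c (σ * τ) = c σ + σ • c τ}
  zero_mem' := ⟨IsLocallyConstant.const 0, fun σ τ => by simp⟩
  add_mem' := by
    rintro a b ⟨ha, ha'⟩ ⟨hb, hb'⟩
    refine ⟨ha.add hb, fun σ τ => ?_⟩
    simp only [Pi.add_apply, ha', hb', smul_add]
    abel
  neg_mem' := by
    rintro a ⟨ha, ha'⟩
    refine ⟨ha.neg, fun σ τ => ?_⟩
    simp only [Pi.neg_apply, ha', smul_neg]
    abel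

/-- The `1`-coboundaries `σ ↦ σ m - m`. -/
def B1 : AddSubgroup (Z1 G M) where
  carrier := {c | ∃ m : M, ∀ σ : G, c.1 σ = σ • m - m}
  zero_mem' := ⟨0, fun σ => by simp⟩
  add_mem' := by
    rintro a b ⟨m, hm⟩ ⟨n, hn⟩
    refine ⟨m + n, fun σ => ?_⟩
    simp only [AddSubgroup.coe_add, Pi.add_apply, hm, hn, smul_add]
    abel
  neg_mem' := by
    rintro a ⟨m, hm⟩
    refine ⟨-m, fun σ => ?_⟩
    simp only [NegMemClass.coe_neg, Pi.neg_apply, hm, smul_neg]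
    abel

/-- The continuous cohomology group `H¹(G, M)`. -/
def H1 : Type _ := Z1 G M ⧸ B1 G M

instance : AddCommGroup (H1 G M) := inferInstanceAs (AddCommGroup (Z1 G M ⧸ B1 G M))

variable {G M}
/-- The class of a cocycle. -/
def H1.mk : Z1 G M →+ H1 G M := QuotientAddGroup.mk' (B1 G M)

variable {G' M' : Type*} [Group G'] [TopologicalSpace G'] [AddCommGroup M'] [DistribMulAction G' M']

/-- A continuous homomorphism `f : G' → G` and a compatible map `φ : M → M'` induce the map
`c ↦ φ ∘ c ∘ f` on cocycles. -/
def Z1.map (f : G' →* G) (hf : Continuous f) (φ : M →+ M')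
    (hφ : ∀ (g : G') (m : M), φ (f g • m) = g • φ m) : Z1 G M →+ Z1 G' M' where
  toFun c := ⟨fun g => φ (c.1 (f g)), (c.2.1.comp_continuous hf).comp φ, fun σ τ => by
    simp only [map_mul, c.2.2, map_add, hφ]⟩
  map_zero' := by ext; simp
  map_add' a b := by ext; simp

/-- The map induced on `H¹` by a compatible pair. -/
def H1.map (f : G' →* G) (hf : Continuous f) (φ : M →+ M')
    (hφ : ∀ (g : G') (m : M), φ (f g • m) = g • φ m) : H1 G M →+ H1 G' M' :=
  QuotientAddGroup.map _ _ (Z1.map f hf φ hφ) (by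
    rintro c ⟨m, hm⟩
    refine ⟨φ m, fun σ => ?_⟩
    change φ (c.1 (f σ)) = _
    rw [hm, map_sub, hφ])

/-- Restriction from a subgroup to a smaller subgroup. -/
def H1.res {H K : Subgroup G} (h : H ≤ K) : H1 K M →+ H1 H M :=
  H1.map (Subgroup.inclusion h) (continuous_inclusion h) (AddMonoidHom.id M) (fun _ _ => rfl)

/-- Conjugation: for a normal subgroup `H`, the element `g` of `G` sends the class of `c` to that
of `σ ↦ g • c (g⁻¹ σ g)`. -/
def H1.conj [IsTopologicalGroup G] (H : Subgroup G) [H.Normal] (g : G) : H1 H M →+ H1 H M :=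
  H1.map (MulAut.conjNormal (H := H) g⁻¹).toMonoidHom
    (by
      refine Continuous.subtype_mk (f := fun x : H => g⁻¹ * (x : G) * g⁻¹⁻¹) ?_ _
      fun_prop)
    (DistribSMul.toAddMonoidHom M g)
    (fun σ m => by
      change g • ((g⁻¹ * (σ : G) * g⁻¹⁻¹) • m) = (σ : G) • g • m
      simp [smul_smul, mul_assoc])

/-- The subgroup `H` acts trivially on its own cohomology. -/
theorem H1.conj_of_mem [IsTopologicalGroup G] (H : Subgroup G) [H.Normal] (g : G) (hg : g ∈ H)
    (x : H1 H M) : H1.conj H g x = x := by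
  induction x using QuotientAddGroup.induction_on with
  | H c =>
    refine Eq.symm (QuotientAddGroup.eq.mpr ?_)
    refine Exists.intro (c.1 ⟨g, hg⟩) fun σ => ?_
    have e : σ * ⟨g, hg⟩ = (⟨g, hg⟩ : H) * MulAut.conjNormal (H := H) g⁻¹ σ := by
      ext
      simp [mul_assoc]
    have h1 := c.2.2 σ ⟨g, hg⟩
    rw [e, c.2.2] at h1
    change -c.1 σ + (⟨g, hg⟩ : H) • c.1 (MulAut.conjNormal (H := H) g⁻¹ σ) = _
    rw [← sub_eq_zero]
    rw [← sub_eq_zero] at h1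
    rw [← h1]
    abel

theorem H1.conj_mul [IsTopologicalGroup G] (H : Subgroup G) [H.Normal] (g h : G)
    (x : H1 H M) : H1.conj H (g * h) x = H1.conj H g (H1.conj H h x) := by
  induction x using QuotientAddGroup.induction_on with
  | H c =>
    refine congrArg (QuotientAddGroup.mk (s := B1 H M)) (Subtype.ext (funext fun σ => ?_))
    change (g * h) • c.1 _ = g • h • c.1 _
    rw [mul_smul]
    congr 3
    refine congrArg c.1 (Subtype.ext ?_)
    simp [mul_assoc]

end Cohomology

/-! ### Points of an elliptic curve with their Galois action -/

section Points

open WeierstrassCurve.Affine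

variable {F : Type*} [Field F] (E : WeierstrassCurve F)

/-- The group `E(Ω)` of points of `E` over an extension field `Ω` of `F`. -/
def Points (Ω : Type*) [Field Ω] [Algebra F Ω] : Type _ :=
  (E.baseChange Ω).toAffine.Point

instance (Ω : Type*) [Field Ω] [Algebra F Ω] : AddCommGroup (Points E Ω) :=
  letI := Classical.decEq Ω
  inferInstanceAs (AddCommGroup (E.baseChange Ω).toAffine.Point)

variable {Ω Ω' : Type*} [Field Ω] [Algebra F Ω] [Field Ω'] [Algebra F Ω']

/-- The map `E(Ω) → E(Ω')` induced by an embedding `Ω → Ω'` over `F`. -/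
def Points.map (f : Ω →ₐ[F] Ω') : Points E Ω →+ Points E Ω' :=
  letI := Classical.decEq Ω
  letI := Classical.decEq Ω'
  Point.map (W' := E) f

theorem Points.map_id (P : Points E Ω) : Points.map E (AlgHom.id F Ω) P = P := by
  cases P <;> rfl

theorem Points.map_map {Ω'' : Type*} [Field Ω''] [Algebra F Ω''] (g : Ω' →ₐ[F] Ω'')
    (f : Ω →ₐ[F] Ω') (P : Points E Ω) :
    Points.map E g (Points.map E f P) = Points.map E (g.comp f) P := by
  cases P <;> rfl

/-- The subgroup `E[r^∞](Ω)` of the points of `E(Ω)` killed by a power of `r`. -/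
def torsion (r : ℕ) (Ω : Type*) [Field Ω] [Algebra F Ω] : AddSubgroup (Points E Ω) where
  carrier := {P | ∃ n : ℕ, r ^ n • P = 0}
  zero_mem' := ⟨0, by simp⟩
  add_mem' := by
    rintro P Q ⟨m, hm⟩ ⟨n, hn⟩
    refine ⟨m + n, ?_⟩
    rw [smul_add, pow_add, mul_smul _ _ Q, hn, smul_zero, mul_comm, mul_smul, hm, smul_zero,
      add_zero]
  neg_mem' := by
    rintro P ⟨m, hm⟩
    exact ⟨m, by rw [smul_neg, hm, neg_zero]⟩

/-- The map `E[r^∞](Ω) → E[r^∞](Ω')` induced by an embedding `Ω → Ω'` over `F`. -/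
def torsion.map (r : ℕ) (f : Ω →ₐ[F] Ω') : torsion E r Ω →+ torsion E r Ω' :=
  ((Points.map E f).comp (torsion E r Ω).subtype).codRestrict (torsion E r Ω') (by
    rintro ⟨P, n, hn⟩
    refine ⟨n, ?_⟩
    change r ^ n • Points.map E f P = 0
    rw [← map_nsmul, hn, map_zero])

section Action

variable {K : Type*} [Field K] [Algebra F K] [Algebra K Ω] [IsScalarTower F K Ω]

/-- `Gal(Ω/K)` acts on `E(Ω)` through its action on coordinates. -/
instance : DistribMulAction Gal(Ω/K) (Points E Ω) where
  smul σ P := Points.map E (σ.toAlgHom.restrictScalars F) P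
  one_smul P := Points.map_id E P
  mul_smul σ τ P := (Points.map_map E (σ.toAlgHom.restrictScalars F)
    (τ.toAlgHom.restrictScalars F) P).symm
  smul_zero _ := map_zero _
  smul_add _ := map_add _

instance (r : ℕ) : DistribMulAction Gal(Ω/K) (torsion E r Ω) where
  smul σ P := torsion.map E r (σ.toAlgHom.restrictScalars F) P
  one_smul P := Subtype.ext (one_smul Gal(Ω/K) P.1)
  mul_smul σ τ P := Subtype.ext (mul_smul σ τ P.1)
  smul_zero _ := map_zero _
  smul_add _ := map_add _

end Action

end Points

/-! ### Separable closures -/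

section SepClosure

/-- The separable closure `K^sep` of `K` (Mathlib's `SeparableClosure`, sealed off in order to
guide instance search). -/
def SepClosure (K : Type*) [Field K] : Type _ := SeparableClosure K

variable (K : Type*) [Field K]

instance : Field (SepClosure K) := inferInstanceAs (Field (SeparableClosure K))

instance (F : Type*) [Field F] [Algebra F K] : Algebra F (SepClosure K) :=
  inferInstanceAs (Algebra F (SeparableClosure K))

instance (F L : Type*) [Field F] [Field L] [Algebra F L] [Algebra L K] [Algebra F K]
    [IsScalarTower F L K] : IsScalarTower F L (SepClosure K) :=
  IsScalarTower.of_algebraMap_eq fun x =>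
    congrArg (algebraMap K (SeparableClosure K)) (IsScalarTower.algebraMap_apply F L K x)

instance : IsSepClosed (SepClosure K) := inferInstanceAs (IsSepClosed (SeparableClosure K))

instance : IsGalois K (SepClosure K) := inferInstanceAs (IsGalois K (SeparableClosure K))

end SepClosure

/-! ### Places and completions -/

section Places

/-- A place of `K`, given by its valuation ring, a valuation subring of `K` other than `K` itself.
(For an algebraic extension `K` of a function field over an algebraic extension of `𝔽_p`, these
are exactly the classes of nontrivial valuations, and all of them have rank one.) -/
def Place (K : Type*) [Field K] : Type _ := {O : ValuationSubring K // O ≠ ⊤}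

variable {K : Type*} [Field K]

/-- The completion `K_v` of `K` at the place `v`. -/
def Place.Completion (v : Place K) : Type _ := v.1.valuation.Completion

instance (v : Place K) : Field v.Completion :=
  inferInstanceAs (Field v.1.valuation.Completion)

/-- The embedding `K → K_v`. -/
def Place.embedding (v : Place K) : K →+* v.Completion :=
  (UniformSpace.Completion.coeRingHom (α := WithVal v.1.valuation)).comp
    (WithVal.equiv v.1.valuation).symm.toRingHom

instance {F : Type*} [Field F] [Algebra F K] (v : Place K) : Algebra F v.Completion :=
  (v.embedding.comp (algebraMap F K)).toAlgebra

instance {F : Type*} [Field F] [Algebra F K] (v : Place K) : IsScalarTower F K v.Completion :=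
  IsScalarTower.of_algebraMap_eq fun _ => rfl

end Places

/-! ### Restriction of Galois groups along an embedding -/

section Restrict

variable {F S K C : Type*} [Field F] [Field S] [Field K] [Field C] [Algebra F S] [Normal F S]
  [Algebra F K] [Algebra K C] [Algebra F C] [IsScalarTower F K C] (j : S →ₐ[F] C)

/-- For `S/F` normal and an embedding `j : S → C` over `F`, the restriction map
`Gal(C/K) → Gal(S/F)` along `j`. -/
def restrictGal : Gal(C/K) →* Gal(S/F) :=
  letI : Algebra S C := j.toRingHom.toAlgebra
  haveI : IsScalarTower F S C := IsScalarTower.of_algebraMap_eq fun x => (j.commutes x).symm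
  IntermediateField.restrictRestrictAlgEquivMapHom F S K C

/-- The restriction `σ'` of `σ` is characterised by `j (σ' x) = σ (j x)`. -/
theorem restrictGal_commutes (σ : Gal(C/K)) (x : S) : j (restrictGal j σ x) = σ (j x) := by
  let _ : Algebra S C := j.toRingHom.toAlgebra
  have _ : IsScalarTower F S C := IsScalarTower.of_algebraMap_eq fun x => (j.commutes x).symm
  exact AlgEquiv.restrictNormal_commutes (MulSemiringAction.toAlgAut Gal(C/K) F C σ) S x

theorem continuous_restrictGal [Algebra.IsIntegral K C] :
    Continuous (restrictGal (K := K) j) := by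
  refine continuous_of_continuousAt_one _ ?_
  rw [ContinuousAt, map_one, Filter.tendsto_def]
  intro s hs
  obtain ⟨M, hM, hMs⟩ := (krullTopology_mem_nhds_one_iff _ _ _).mp hs
  have _ : FiniteDimensional F M := hM
  let t : Set S := Set.range fun i => (Module.finBasis F M i : S)
  have ht : ∀ x : M, (x : S) ∈ Submodule.span F t := fun x => by
    rw [← (Module.finBasis F M).sum_repr x]
    push_cast
    exact Submodule.sum_mem _ fun i _ =>
      Submodule.smul_mem _ _ (Submodule.subset_span ⟨i, rfl⟩)
  let N : IntermediateField K C := IntermediateField.adjoin K (j '' t)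
  have _ : Finite (j '' t) := ((Set.finite_range _).image _).to_subtype
  have _ : FiniteDimensional K N :=
    IntermediateField.finiteDimensional_adjoin fun x _ => Algebra.IsIntegral.isIntegral x
  refine (krullTopology_mem_nhds_one_iff _ _ _).mpr ⟨N, inferInstance, fun σ hσ => hMs ?_⟩
  have hσ' := (IntermediateField.mem_fixingSubgroup_iff N σ).mp hσ
  refine (IntermediateField.mem_fixingSubgroup_iff M _).mpr fun x hx => ?_
  refine Submodule.span_induction (p := fun y _ => restrictGal j σ y = y) ?_ (map_zero _)
    (fun a b _ _ ha hb => by rw [map_add, ha, hb]) (fun a b _ hb => by rw [map_smul, hb])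
    (ht ⟨x, hx⟩)
  intro y hy
  apply j.injective
  refine (restrictGal_commutes j σ y).trans ?_
  exact hσ' _ (IntermediateField.subset_adjoin _ _ ⟨y, hy, rfl⟩)

end Restrict

section Lift

variable {F S C : Type*} [Field F] [Field S] [Field C] [Algebra F S] [Algebra F C]

variable (F S C) in
/-- For `S/L` separable algebraic and `C` separably closed, a chosen embedding `S → C` over `L`,
regarded as a map of `F`-algebras. -/
def sepLift (L : Type*) [Field L] [Algebra F L] [Algebra L S] [Algebra L C] [IsScalarTower F L S]
    [IsScalarTower F L C] [Algebra.IsSeparable L S] [IsSepClosed C] : S →ₐ[F] C :=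
  (IsSepClosed.lift : S →ₐ[L] C).restrictScalars F

theorem sepLift_algebraMap (L : Type*) [Field L] [Algebra F L] [Algebra L S] [Algebra L C]
    [IsScalarTower F L S] [IsScalarTower F L C] [Algebra.IsSeparable L S] [IsSepClosed C] (x : L) :
    sepLift F S C L (algebraMap L S x) = algebraMap L C x :=
  (IsSepClosed.lift : S →ₐ[L] C).commutes x

end Lift

/-! ### Selmer groups -/

section Selmer

variable {F : Type u} [Field F] (E : WeierstrassCurve F) (r : ℕ)

/-- `H¹(K, E[r^∞])` for an extension field `K` of `F`, with `G_K = Gal(K^sep/K)`. -/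
abbrev galH1 (K : Type*) [Field K] [Algebra F K] : Type _ :=
  H1 Gal(SepClosure K/K) (torsion E r (SepClosure K))

/-- The image of the Kummer map `κ : E(K) ⊗ ℚ_r/ℤ_r → H¹(K, E[r^∞])`. The element
`P ⊗ 1/r^k` is sent to the class of `σ ↦ σ Q - Q`, where `Q ∈ E(K^sep)` satisfies `r^k Q = P`. -/
def kummerImage (K : Type*) [Field K] [Algebra F K] : AddSubgroup (galH1 E r K) where
  carrier := {x | ∃ c : Z1 Gal(SepClosure K/K) (torsion E r (SepClosure K)),
    H1.mk c = x ∧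
    ∃ (P : Points E K) (k : ℕ) (Q : Points E (SepClosure K)),
      r ^ k • Q = Points.map E (IsScalarTower.toAlgHom F K (SepClosure K)) P ∧
      ∀ σ : Gal(SepClosure K/K), (c.1 σ : Points E (SepClosure K)) = σ • Q - Q}
  zero_mem' := ⟨0, rfl, 0, 0, 0, by simp, fun σ => by simp⟩
  add_mem' := by
    rintro _ _ ⟨c, rfl, P, k, Q, hQ, hc⟩ ⟨c', rfl, P', k', Q', hQ', hc'⟩
    refine ⟨c + c', rfl, r ^ k' • P + r ^ k • P', k + k', Q + Q', ?_, fun σ => ?_⟩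
    · rw [map_add, map_nsmul, map_nsmul, ← hQ, ← hQ', smul_add, pow_add, mul_smul _ _ Q',
        mul_comm, mul_smul]
    · have h : ((c + c').1 σ : Points E (SepClosure K)) = c.1 σ + c'.1 σ := rfl
      rw [h, hc, hc', smul_add]
      abel
  neg_mem' := by
    rintro _ ⟨c, rfl, P, k, Q, hQ, hc⟩
    refine ⟨-c, rfl, -P, k, -Q, by rw [smul_neg, hQ, map_neg], fun σ => ?_⟩
    have h : ((-c).1 σ : Points E (SepClosure K)) = -c.1 σ := rfl
    rw [h, hc, smul_neg]
    abel

variable (L : IntermediateField F (SepClosure F))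

/-- `H¹(L, E[r^∞])` for a field `L` between `F` and `F^sep`. Here `L^sep = F^sep` and
`G_L = Gal(F^sep/L)` is the subgroup of `G_F` that fixes `L`. -/
abbrev globalH1 : Type _ := H1 L.fixingSubgroup (torsion E r (SepClosure F))

variable {L}

/-- The chosen embedding `F^sep → (L_v)^sep` over `L`. -/
def sepEmbedding (v : Place L) : SepClosure F →ₐ[F] SepClosure v.Completion :=
  sepLift F (SepClosure F) (SepClosure v.Completion) L

theorem sepEmbedding_coe (v : Place L) (x : L) : sepEmbedding v (x : SepClosure F) =
    algebraMap v.Completion (SepClosure v.Completion) (algebraMap L v.Completion x) :=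
  sepLift_algebraMap (C := SepClosure v.Completion) L x

/-- The homomorphism `G_{L_v} → G_L` given by restriction along the chosen embedding. -/
def decomposition (v : Place L) :
    Gal(SepClosure v.Completion/v.Completion) →* L.fixingSubgroup :=
  (restrictGal (sepEmbedding v)).codRestrict L.fixingSubgroup fun σ => by
    rw [IntermediateField.mem_fixingSubgroup_iff]
    intro x hx
    apply (sepEmbedding v).injective
    refine (restrictGal_commutes (sepEmbedding v) σ x).trans ?_
    have h := sepEmbedding_coe v ⟨x, hx⟩
    exact (congrArg σ h).trans ((σ.commutes _).trans h.symm)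

/-- The localisation map `H¹(L, E[r^∞]) → H¹(L_v, E[r^∞])`. -/
def localisation (v : Place L) : globalH1 E r L →+ galH1 E r v.Completion :=
  H1.map (decomposition v) ((continuous_restrictGal (sepEmbedding v)).subtype_mk _)
    (torsion.map E r (sepEmbedding v))
    (fun σ P => Subtype.ext (by
      change Points.map E _ (Points.map E _ P.1) = Points.map E _ (Points.map E _ P.1)
      rw [Points.map_map, Points.map_map]
      congr 2
      exact AlgHom.ext fun x => restrictGal_commutes (sepEmbedding v) σ x))

variable (L)

/-- The `r`-part `Sel_E(L)_r` of the Selmer group of `E` over `L` (for `r ≠ char F`, so that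
Galois cohomology may be used): the kernel of the map
`H¹(L, E[r^∞]) → ∏_v H¹(L_v, E[r^∞]) / Im κ_v`, over all places `v` of `L`. -/
def selmer : AddSubgroup (globalH1 E r L) :=
  (AddMonoidHom.pi fun v : Place L =>
    (QuotientAddGroup.mk' (kummerImage E r v.Completion)).comp (localisation E r v)).ker

/-- The restriction map `H¹(L, E[r^∞]) → H¹(L', E[r^∞])` for `L ⊆ L'`. -/
def restriction {L L' : IntermediateField F (SepClosure F)} (h : L ≤ L') :
    globalH1 E r L →+ globalH1 E r L' :=
  H1.res (IntermediateField.fixingSubgroup_le h)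

variable [IsGalois F L]

/-- The action of `γ ∈ Gal(L/F)` on `H¹(L, E[r^∞])`, by conjugation with a lift of `γ` to `G_F`. -/
def galAct (γ : Gal(L/F)) : globalH1 E r L →+ globalH1 E r L :=
  H1.conj L.fixingSubgroup (γ.liftNormal (SepClosure F))

/-- The action may be computed with any lift. -/
theorem galAct_restrictNormal (g : Gal(SepClosure F/F)) (x : globalH1 E r L) :
    galAct E r L (g.restrictNormal L) x = H1.conj L.fixingSubgroup g x := by
  set g' := (g.restrictNormal L).liftNormal (SepClosure F) with hg'
  have h : g⁻¹ * g' ∈ L.fixingSubgroup := by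
    rw [IntermediateField.mem_fixingSubgroup_iff]
    intro y hy
    have h1 : g' y = g y :=
      ((g.restrictNormal L).liftNormal_commutes (SepClosure F) ⟨y, hy⟩).trans
        (g.restrictNormal_commutes L ⟨y, hy⟩)
    rw [AlgEquiv.mul_apply, h1]
    exact g.symm_apply_apply y
  have e : g' = g * (g⁻¹ * g') := by group
  change H1.conj L.fixingSubgroup g' x = _
  rw [e, H1.conj_mul, H1.conj_of_mem _ _ h]

/-- The subgroup `Sel_E(L)_r^U` of the elements of `Sel_E(L)_r` fixed by a subgroup `U` of
`Gal(L/F)`. -/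
def selmerInvariants (U : Subgroup Gal(L/F)) : AddSubgroup (globalH1 E r L) where
  carrier := {x | x ∈ selmer E r L ∧ ∀ γ ∈ U, galAct E r L γ x = x}
  zero_mem' := ⟨zero_mem _, fun γ _ => map_zero _⟩
  add_mem' := fun ha hb => ⟨add_mem ha.1 hb.1, fun γ h => by rw [map_add, ha.2 γ h, hb.2 γ h]⟩
  neg_mem' := fun ha => ⟨neg_mem ha.1, fun γ h => by rw [map_neg, ha.2 γ h]⟩

end Selmer

/-! ### Reduction type -/

/-- At every place `O` of `F`, a minimal equation of `E` has good or split multiplicative reduction.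
(The nontrivial valuation rings of a function field are all discrete.) -/
def GoodOrSplitMultiplicative {F : Type*} [Field F] (E : WeierstrassCurve F) : Prop :=
  ∀ (O : ValuationSubring F) [IsDiscreteValuationRing O],
    ∃ C : WeierstrassCurve.VariableChange F,
      (C • E).HasGoodReduction O ∨ (C • E).HasSplitMultiplicativeReduction O

end SelmerControl

end

noncomputable section
namespace SelmerControl

/-! ### Averaging over quotients of order prime to the torsion -/

section Averaging

open Topology Filter

/-! Globally, Γ_n is pro-`l` and the coefficients are `r`-primary with `r ≠ l`. Hence `H¹` and `H²`
of Γ_n with values in `E[r^∞](ℱ)` vanish, and inflation-restriction makes `H¹(F_n) → H¹(ℱ)^{Γ_n}` an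
isomorphism. No `H²` appears in the code. Both halves are averages over cosets of an open subgroup
of `l`-power index, an index invertible on `r`-power torsion: `exists_coboundary_of_ker` gives
injectivity, `exists_cocycle_of_invariant` gives surjectivity.

It remains to see that a class over F_n is Selmer exactly when its restriction to `ℱ` is. By
`mk_mem_kummerImage_iff` the local condition says that the cocycle becomes a coboundary in the full
group of points over the separable closure. It clearly passes up to a larger field. The way down is
`LocallyTrivial.of_res`. The field `M = ℱ_w` is the completion of a possibly infinite extension, so
it need not be algebraic over `K = (F_n)_v`, and a trivialising point `Q` over `M^sep` must first be
made algebraic over `K`.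

A multiple `r^k Q` lies in `E(M)`. Since `r` is invertible, multiplication by `r^k` is étale, so
modulo `r^k E(M)` every point of `E(M)` is a sum of two points whose `x`-coordinates lie in the
dense subfield `ℱ`. Such points are defined over `F^sep`, and so are their `r^k`-division points.
Hence `Q = Q₀ + R` with `Q₀` over `F^sep` and `R` in `E(M)`, and `R` does not affect the coboundary
(`exists_eq_map_add_map`). So `Q₀` trivialises the cocycle on the automorphisms over `K` that fix
`ℱ`, and averaging over the remaining pro-`l` quotient finishes.

The étaleness is used through the invariant differential: a tangent vector `ω` at `P` gives `nω` at
`nP`. The same algebra (`addX_tangent`, `addY_tangent`, `exists_chain`) serves derivations, for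
division over separably closed fields, and strict derivatives, for the inverse function theorem over
complete fields. All places involved have rank one, so the completions are normed fields. -/

theorem exists_pow_smul_eq_zero {X M : Type*} [TopologicalSpace X] [CompactSpace X]
    [AddCommGroup M] {r : ℕ} (c : X → M) (hc : IsLocallyConstant c)
    (htors : ∀ σ, ∃ k : ℕ, r ^ k • c σ = 0) : ∃ k : ℕ, ∀ σ, r ^ k • c σ = 0 := by
  have hfin : (Set.range c).Finite := hc.range_finite
  rcases isEmpty_or_nonempty X with _ | _
  · exact ⟨0, fun σ => isEmptyElim σ⟩
  choose! k hk using htors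
  choose! g hg using fun (m : M) (hm : m ∈ Set.range c) => hm
  -- The range is finite, so the sum of one exponent for each value bounds them all.
  refine ⟨∑ m ∈ hfin.toFinset, k (g m), fun σ => ?_⟩
  have hm : c σ ∈ hfin.toFinset := by simp
  obtain ⟨j, hj⟩ := Nat.exists_eq_add_of_le
    (Finset.single_le_sum (f := fun m => k (g m)) (fun _ _ => Nat.zero_le _) hm)
  rw [hj, pow_add, mul_comm, mul_smul]
  have := hk (g (c σ))
  rw [hg _ ⟨σ, rfl⟩] at this
  rw [this, smul_zero]

variable {G : Type*} [Group G] [TopologicalSpace G]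

/-- The image of the complement of `U` is compact, hence closed, and misses `1` because `U` contains
the kernel. The powers of `π σ` tend to `1`, so they eventually leave it. -/
theorem exists_pow_mem_of_ker_le [CompactSpace G] {Γ : Type*} [Group Γ] [TopologicalSpace Γ]
    [T2Space Γ] {l : ℕ} (hΓ : ∀ γ : Γ, Tendsto (fun s : ℕ => γ ^ l ^ s) atTop (𝓝 1))
    (π : G →* Γ) (hπ : Continuous π) (U : Subgroup G) (hU : IsOpen (U : Set G))
    (hker : π.ker ≤ U) (σ : G) : ∃ s : ℕ, σ ^ l ^ s ∈ U := by
  have hcl : IsClosed (π '' (U : Set G)ᶜ) := (hU.isClosed_compl.isCompact.image hπ).isClosed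
  have h1 : (1 : Γ) ∉ π '' (U : Set G)ᶜ := by
    rintro ⟨x, hx, hx1⟩
    exact hx (hker hx1)
  obtain ⟨s, hs⟩ := ((hΓ (π σ)).eventually (hcl.isOpen_compl.mem_nhds h1)).exists
  refine ⟨s, by_contra fun h => hs ⟨σ ^ l ^ s, h, map_pow _ _ _⟩⟩

variable [IsTopologicalGroup G]

/-- The normal core of `U` is again open and contains the kernel; the quotient by it is a finite
`l`-group, whose order the index of `U` divides. -/
theorem index_eq_pow_of_ker_le [CompactSpace G] {Γ : Type*} [Group Γ] [TopologicalSpace Γ]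
    [T2Space Γ] {l : ℕ} [hl : Fact l.Prime]
    (hΓ : ∀ γ : Γ, Tendsto (fun s : ℕ => γ ^ l ^ s) atTop (𝓝 1))
    (π : G →* Γ) (hπ : Continuous π) (U : Subgroup G) (hU : IsOpen (U : Set G))
    (hker : π.ker ≤ U) : U.FiniteIndex ∧ ∃ m : ℕ, U.index = l ^ m := by
  have hfin : U.FiniteIndex := by
    have := Subgroup.quotient_finite_of_isOpen U hU
    exact Subgroup.finiteIndex_of_finite_quotient
  refine ⟨hfin, ?_⟩
  have hcore : IsOpen (U.normalCore : Set G) :=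
    Subgroup.isOpen_of_isClosed_of_finiteIndex _ (U.normalCore_isClosed (U.isClosed_of_isOpen hU))
  have hker' : π.ker ≤ U.normalCore := Subgroup.normal_le_normalCore.mpr hker
  have hp : IsPGroup l (G ⧸ U.normalCore) := by
    intro x
    induction x using QuotientGroup.induction_on with
    | H σ =>
      obtain ⟨s, hs⟩ := exists_pow_mem_of_ker_le hΓ π hπ _ hcore hker' σ
      exact ⟨s, by rw [← QuotientGroup.mk_pow]; exact (QuotientGroup.eq_one_iff _).mpr hs⟩
  have : Finite (G ⧸ U.normalCore) := Subgroup.finite_quotient_of_finiteIndex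
  obtain ⟨n, hn⟩ := IsPGroup.iff_card.mp hp
  have hdvd : U.index ∣ l ^ n := hn ▸ Subgroup.index_dvd_of_le U.normalCore_le
  obtain ⟨m, -, hm⟩ := (Nat.dvd_prime_pow hl.out).mp hdvd
  exact ⟨m, hm⟩

theorem isLocallyConstant_of_mul_right {M : Type*} {f : G → M} (V : Subgroup G)
    (hV : IsOpen (V : Set G)) (h : ∀ g, ∀ v ∈ V, f (g * v) = f g) : IsLocallyConstant f := by
  refine (IsLocallyConstant.iff_exists_open f).mpr fun x =>
    ⟨(fun y => x⁻¹ * y) ⁻¹' V, hV.preimage (continuous_const.mul continuous_id), by simp, ?_⟩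
  intro y hy
  have := h x _ hy
  simpa using this

variable {M : Type*} [AddCommGroup M] [DistribMulAction G M]

/-- `N'` is an inverse of `N` modulo `r ^ k`. -/
theorem exists_nat_smul_eq {N r k : ℕ} (hr : r ≠ 0) (h : N.Coprime r) :
    ∃ N' : ℕ, ∀ m : M, r ^ k • m = 0 → N' • N • m = m := by
  obtain ⟨N', -, hN'⟩ := Nat.exists_mul_mod_eq_of_coprime 1 (h.pow_right k) (pow_ne_zero k hr)
  refine ⟨N', fun m hm => ?_⟩
  have key : ∀ a : ℕ, a • m = (a % r ^ k) • m := fun a => by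
    conv_lhs => rw [← Nat.mod_add_div a (r ^ k), add_smul, mul_comm, mul_smul, hm, smul_zero,
      add_zero]
  rw [smul_smul, mul_comm, key, hN', ← key, one_smul]

/-- A torsion cocycle of a compact group that becomes a coboundary on the kernel of a map to a
pro-`l` group is a coboundary, if the torsion is prime to `l`. -/
theorem exists_coboundary_of_ker [CompactSpace G] {Γ : Type*} [Group Γ] [TopologicalSpace Γ]
    [T2Space Γ] {l r : ℕ} [Fact l.Prime] (hr : r ≠ 0) (hlr : l.Coprime r)
    (hΓ : ∀ γ : Γ, Tendsto (fun s : ℕ => γ ^ l ^ s) atTop (𝓝 1))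
    (π : G →* Γ) (hπ : Continuous π) (hM : ∀ m : M, IsLocallyConstant fun g : G => g • m)
    (c : G → M) (hc : IsLocallyConstant c) (hcoc : ∀ σ τ, c (σ * τ) = c σ + σ • c τ)
    {k : ℕ} (htors : ∀ σ, r ^ k • c σ = 0) (Q : M) (hQ : ∀ σ ∈ π.ker, c σ = σ • Q - Q) :
    ∃ Q' : M, ∀ σ, c σ = σ • Q' - Q' := by
  -- Subtracting the coboundary of `Q` makes the cocycle vanish on the kernel. Its zero set `W` is
  -- then an open subgroup of `l`-power index, and `d` factors through the left cosets of `W`.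
  set d : G → M := fun σ => c σ - (σ • Q - Q) with hd
  have hdlc : IsLocallyConstant d := hc.sub ((hM Q).sub (IsLocallyConstant.const Q))
  have hdcoc : ∀ σ τ, d (σ * τ) = d σ + σ • d τ := fun σ τ => by
    simp only [hd, hcoc, mul_smul, smul_sub]
    abel
  have hd1 : d 1 = 0 := by simpa using hdcoc 1 1
  let W : Subgroup G :=
    { carrier := {σ | d σ = 0}
      one_mem' := hd1
      mul_mem' := fun {a b} ha hb => by
        change d _ = 0
        rw [hdcoc, show d a = 0 from ha, show d b = 0 from hb, smul_zero, add_zero]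
      inv_mem' := fun {a} ha => by
        change d _ = 0
        have := hdcoc a⁻¹ a
        rw [inv_mul_cancel, hd1, show d a = 0 from ha, smul_zero, add_zero] at this
        exact this.symm }
  have hWo : IsOpen (W : Set G) := hdlc.isOpen_fiber 0
  have hker : π.ker ≤ W := fun σ hσ => by
    change d σ = 0
    simp only [hd]
    rw [hQ σ hσ, sub_self]
  obtain ⟨hfin, m, hm⟩ := index_eq_pow_of_ker_le hΓ π hπ W hWo hker
  have hcop : W.index.Coprime r := hm ▸ hlr.pow_left m
  have : Fintype (G ⧸ W) := Fintype.ofFinite _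
  let d' : G ⧸ W → M := Quotient.lift d fun a b hab => by
    have h := hdcoc a (a⁻¹ * b)
    rw [mul_inv_cancel_left, show d (a⁻¹ * b) = 0 from QuotientGroup.leftRel_apply.mp hab,
      smul_zero, add_zero] at h
    exact h.symm
  have hd' : ∀ (σ : G) (q : G ⧸ W), d' (σ • q) = d σ + σ • d' q := fun σ q => by
    induction q using QuotientGroup.induction_on with
    | H τ => exact hdcoc σ τ
  set a : M := ∑ q, d' q with ha
  -- Summing the cocycle relation over all cosets shows that `W.index • d` is the coboundary of
  -- `-a`.
  have hsum : ∀ σ, a = W.index • d σ + σ • a := fun σ => by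
    have h1 : ∑ q, d' (σ • q) = a := Fintype.sum_equiv (MulAction.toPerm σ) _ _ fun _ => rfl
    simp only [hd', Finset.sum_add_distrib, Finset.sum_const, ← Finset.smul_sum] at h1
    rw [← ha, Finset.card_univ, ← Nat.card_eq_fintype_card] at h1
    exact h1.symm
  -- The index is inverted only on the values of `c`: the point `Q`, and with it `d`, need not be
  -- torsion.
  obtain ⟨N', hN'⟩ := exists_nat_smul_eq (M := M) (k := k) hr hcop
  refine ⟨N' • (W.index • Q - a), fun σ => ?_⟩
  have h3 : W.index • d σ = a - σ • a := eq_sub_of_add_eq (hsum σ).symm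
  have h4 : W.index • c σ = σ • (W.index • Q - a) - (W.index • Q - a) := by
    have h2 : c σ = d σ + (σ • Q - Q) := by simp only [hd]; abel
    rw [h2, smul_add, h3, smul_sub, smul_sub, smul_comm σ]
    abel
  rw [← hN' _ (htors σ), h4, smul_sub, smul_comm σ]

/-- Extension of a cocycle from a closed normal subgroup `N` to `N V` for some open normal `V`. -/
theorem exists_cocycle_extension [CompactSpace G] [TotallyDisconnectedSpace G]
    (hM : ∀ m : M, IsLocallyConstant fun g : G => g • m)
    (N : Subgroup G) [N.Normal] (hN : IsClosed (N : Set G))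
    (c : G → M) (hc : IsLocallyConstant fun x : N => c x)
    (hcoc : ∀ σ ∈ N, ∀ τ ∈ N, c (σ * τ) = c σ + σ • c τ) :
    ∃ (V : Subgroup G) (f : G → M), V.Normal ∧ IsOpen (V : Set G) ∧ (∀ n ∈ N, f n = c n) ∧
      (∀ g, ∀ v ∈ V, f (g * v) = f g) ∧
      ∀ σ ∈ N ⊔ V, ∀ τ ∈ N ⊔ V, f (σ * τ) = f σ + σ • f τ := by
  have : CompactSpace N := isCompact_iff_compactSpace.mp hN.isCompact
  have hfin : (Set.range fun x : N => c x).Finite := hc.range_finite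
  have hc1 : c 1 = 0 := by simpa using hcoc 1 N.one_mem 1 N.one_mem
  obtain ⟨O, hO, hON⟩ := isOpen_induced_iff.mp (hc.isOpen_fiber 0)
  -- On `T` two things hold: `c` vanishes at the elements of `N`, and the finitely many values of
  -- `c` are fixed. This makes `n v ↦ c n` well defined and a cocycle on `N V`.
  let T : Set G := O ∩ ⋂ m ∈ Set.range fun x : N => c x, {g | g • m = m}
  have hT : IsOpen T := hO.inter (hfin.isOpen_biInter fun m _ => (hM m).isOpen_fiber m)
  have h1T : (1 : G) ∈ T := by
    refine ⟨?_, by simp⟩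
    have : (1 : N) ∈ ((↑) : N → G) ⁻¹' O := by
      rw [hON]
      exact hc1
    exact this
  obtain ⟨V, hVn, hVo, hV⟩ : ∃ V : Subgroup G, V.Normal ∧ IsOpen (V : Set G) ∧ (V : Set G) ⊆ T :=
    have ⟨V, hV⟩ := ProfiniteGrp.exist_openNormalSubgroup_sub_open_nhds_of_one hT h1T
    ⟨V.toSubgroup, inferInstance, V.isOpen, hV⟩
  have hVc : ∀ n ∈ N, n ∈ V → c n = 0 := fun n hn hnV => by
    have : (⟨n, hn⟩ : N) ∈ ((↑) : N → G) ⁻¹' O := (hV hnV).1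
    rw [hON] at this
    exact this
  have hVs : ∀ v ∈ V, ∀ n ∈ N, v • c n = c n := fun v hv n hn => by
    have := (hV hv).2
    simp only [Set.mem_iInter] at this
    exact this _ ⟨⟨n, hn⟩, rfl⟩
  have hwd : ∀ n ∈ N, ∀ n' ∈ N, n⁻¹ * n' ∈ V → c n' = c n := fun n hn n' hn' h => by
    have := hcoc n hn (n⁻¹ * n') (N.mul_mem (N.inv_mem hn) hn')
    rwa [mul_inv_cancel_left, hVc _ (N.mul_mem (N.inv_mem hn) hn') h, smul_zero, add_zero] at this
  classical
  let f : G → M := fun g => if h : ∃ n ∈ N, n⁻¹ * g ∈ V then c h.choose else 0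
  have hf : ∀ g, ∀ n ∈ N, n⁻¹ * g ∈ V → f g = c n := fun g n hn h => by
    have hex : ∃ n ∈ N, n⁻¹ * g ∈ V := ⟨n, hn, h⟩
    simp only [f, dif_pos hex]
    refine hwd n hn _ hex.choose_spec.1 ?_
    have h2 := V.mul_mem h (V.inv_mem hex.choose_spec.2)
    simpa [mul_assoc] using h2
  have hfV : ∀ g, ∀ v ∈ V, f (g * v) = f g := fun g v hv => by
    by_cases hex : ∃ n ∈ N, n⁻¹ * g ∈ V
    · obtain ⟨n, hn, h⟩ := hex
      rw [hf g n hn h, hf (g * v) n hn (by rw [← mul_assoc]; exact V.mul_mem h hv)]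
    · have hex' : ¬ ∃ n ∈ N, n⁻¹ * (g * v) ∈ V := by
        rintro ⟨n, hn, h⟩
        refine hex ⟨n, hn, ?_⟩
        have := V.mul_mem h (V.inv_mem hv)
        simpa [mul_assoc] using this
      simp only [f, dif_neg hex, dif_neg hex']
  have hdec : ∀ u ∈ N ⊔ V, ∃ n ∈ N, ∃ v ∈ V, n * v = u :=
    fun u hu => by
      rw [← SetLike.mem_coe, Subgroup.mul_normal] at hu
      exact Set.mem_mul.mp hu
  refine ⟨V, f, hVn, hVo, fun n hn => hf n n hn (by simp [V.one_mem]),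
    hfV, fun σ hσ τ hτ => ?_⟩
  · obtain ⟨n, hn, v, hv, rfl⟩ := hdec σ hσ
    obtain ⟨n', hn', v', hv', rfl⟩ := hdec τ hτ
    have e : n * v * (n' * v') = n * n' * (n'⁻¹ * v * n' * v') := by group
    have hv2 : n'⁻¹ * v * n' ∈ V := by
      simpa using hVn.conj_mem v hv n'⁻¹
    have hfn : ∀ n ∈ N, f n = c n := fun n hn => hf n n hn (by simp [V.one_mem])
    rw [e, hfV _ _ (V.mul_mem hv2 hv'), hfV _ v hv, hfV _ v' hv', hfn _ hn, hfn _ hn',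
      hfn _ (N.mul_mem hn hn'), hcoc n hn n' hn', mul_smul, hVs v hv n' hn']

/-- A cocycle on the kernel of a map to a pro-`l` group whose class is invariant is the restriction
of a cocycle, up to a coboundary, if its values are torsion prime to `l`. -/
theorem exists_cocycle_of_invariant [CompactSpace G] [TotallyDisconnectedSpace G]
    {Γ : Type*} [Group Γ] [TopologicalSpace Γ]
    [T2Space Γ] {l r : ℕ} [Fact l.Prime] (hr : r ≠ 0) (hlr : l.Coprime r)
    (hΓ : ∀ γ : Γ, Tendsto (fun s : ℕ => γ ^ l ^ s) atTop (𝓝 1))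
    (π : G →* Γ) (hπ : Continuous π) (hM : ∀ m : M, IsLocallyConstant fun g : G => g • m)
    (c : G → M) (hc : IsLocallyConstant fun x : π.ker => c x)
    (hcoc : ∀ σ ∈ π.ker, ∀ τ ∈ π.ker, c (σ * τ) = c σ + σ • c τ)
    (htors : ∀ σ : π.ker, ∃ k : ℕ, r ^ k • c σ = 0)
    (hinv : ∀ g : G, ∃ m : M, ∀ σ ∈ π.ker, g • c (g⁻¹ * σ * g) = c σ + (σ • m - m)) :
    ∃ c' : G → M, IsLocallyConstant c' ∧ (∀ σ τ, c' (σ * τ) = c' σ + σ • c' τ) ∧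
      ∃ m : M, ∀ σ ∈ π.ker, c' σ = c σ + (σ • m - m) := by
  have hNcl : IsClosed (π.ker : Set G) := isClosed_singleton.preimage hπ
  have : CompactSpace π.ker := isCompact_iff_compactSpace.mp hNcl.isCompact
  obtain ⟨k, hk⟩ := exists_pow_smul_eq_zero _ hc htors
  obtain ⟨V, f, hVn, hVo, hfc, hfV, hfcoc⟩ := exists_cocycle_extension hM π.ker hNcl c hc hcoc
  set U := π.ker ⊔ V with hUdef
  have hU : IsOpen (U : Set G) := Subgroup.isOpen_mono le_sup_right hVo
  obtain ⟨hfin, e, he⟩ := index_eq_pow_of_ker_le hΓ π hπ U hU le_sup_left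
  have hcop : U.index.Coprime r := he ▸ hlr.pow_left e
  have : Fintype (G ⧸ U) := Fintype.ofFinite _
  let s : G ⧸ U → G := Quotient.out
  have hs : ∀ q, (s q : G ⧸ U) = q := fun q => Quotient.out_eq' q
  have hsU : ∀ (g : G) (q : G ⧸ U), (s (g • q))⁻¹ * (g * s q) ∈ U := fun g q => by
    rw [← QuotientGroup.eq, hs]
    conv_lhs => rw [← hs q]
    rfl
  -- The corestriction of `f` from `U` to `G`, written with the coset representatives `s`. The
  -- arguments of `f` lie in `U`, where `f` is a cocycle.
  let cor : G → M := fun g => ∑ q, s (g • q) • f ((s (g • q))⁻¹ * (g * s q))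
  have hker : ∀ g ∈ U.normalCore, ∀ q : G ⧸ U, g • q = q := fun g hg q => by
    conv_lhs => rw [← hs q]
    conv_rhs => rw [← hs q]
    refine (QuotientGroup.eq.mpr ?_).symm
    have := hg (s q)⁻¹
    simpa [mul_assoc] using this
  have hVcore : V ≤ U.normalCore := Subgroup.normal_le_normalCore.mpr le_sup_right
  have hNcore : π.ker ≤ U.normalCore := Subgroup.normal_le_normalCore.mpr le_sup_left
  have hcorlc : IsLocallyConstant cor := isLocallyConstant_of_mul_right V hVo fun g v hv => by
    refine Finset.sum_congr rfl fun q _ => ?_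
    rw [mul_smul, hker v (hVcore hv)]
    have e1 : (s (g • q))⁻¹ * (g * v * s q) =
        (s (g • q))⁻¹ * (g * s q) * ((s q)⁻¹ * v * s q) := by group
    rw [e1, hfV]
    simpa using hVn.conj_mem v hv (s q)⁻¹
  have hcorcoc : ∀ σ τ, cor (σ * τ) = cor σ + σ • cor τ := fun σ τ => by
    have h1 : cor σ = ∑ q, s (σ • τ • q) • f ((s (σ • τ • q))⁻¹ * (σ * s (τ • q))) :=
      (Fintype.sum_equiv (MulAction.toPerm τ) _ _ fun _ => rfl).symm
    rw [h1, Finset.smul_sum, ← Finset.sum_add_distrib]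
    refine Finset.sum_congr rfl fun q _ => ?_
    have e1 : (s ((σ * τ) • q))⁻¹ * (σ * τ * s q) =
        (s (σ • τ • q))⁻¹ * (σ * s (τ • q)) * ((s (τ • q))⁻¹ * (τ * s q)) := by
      rw [mul_smul]
      group
    rw [e1, hfcoc _ (hsU _ _) _ (hsU _ _), mul_smul σ τ q, smul_add, smul_smul, smul_smul,
      mul_inv_cancel_left, smul_smul]
  choose m hm using hinv
  -- The kernel acts trivially on the cosets of `U`, so each summand is a conjugate of `c`. By
  -- invariance it is `c` plus a coboundary, and the sum is `U.index • c` up to a coboundary.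
  have hcorN : ∀ σ ∈ π.ker, cor σ =
      U.index • c σ + (σ • (∑ q, m (s q)) - ∑ q, m (s q)) := fun σ hσ => by
    have h1 : ∀ q : G ⧸ U, s (σ • q) • f ((s (σ • q))⁻¹ * (σ * s q)) =
        c σ + (σ • m (s q) - m (s q)) := fun q => by
      have h2 : (s q)⁻¹ * σ * s q ∈ π.ker := by
        simpa using (inferInstance : π.ker.Normal).conj_mem σ hσ (s q)⁻¹
      rw [hker σ (hNcore hσ), ← mul_assoc, hfc _ h2, hm _ σ hσ]
    simp only [cor, h1, Finset.sum_add_distrib, Finset.sum_sub_distrib, Finset.sum_const,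
      Finset.smul_sum]
    rw [Finset.card_univ, ← Nat.card_eq_fintype_card]
    rfl
  obtain ⟨N', hN'⟩ := exists_nat_smul_eq (M := M) (k := k) hr hcop
  refine ⟨fun g => N' • cor g, hcorlc.comp (N' • ·), fun σ τ => ?_, N' • ∑ q, m (s q),
    fun σ hσ => ?_⟩
  · simp only [hcorcoc, smul_add, smul_comm σ]
  · simp only [hcorN σ hσ, smul_add, smul_sub, hN' _ (hk ⟨σ, hσ⟩), smul_comm σ]

end Averaging

/-! ### Tangent vectors and the chord law -/

section Tangent

open WeierstrassCurve.Affine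

variable {K : Type*} [Field K] (W : WeierstrassCurve.Affine K)

/-- The partial derivative of the Weierstrass polynomial with respect to `X`. -/
def partialX (x y : K) : K := W.a₁ * y - 3 * x ^ 2 - 2 * W.a₂ * x - W.a₄

/-- The partial derivative of the Weierstrass polynomial with respect to `Y`. -/
def partialY (x y : K) : K := 2 * y + W.a₁ * x + W.a₃

variable {W}

/-- Additivity of the invariant differential `dx / (2y + a₁x + a₃)` under the chord law. A tangent
vector is recorded by the `ω` with `dx = ω ∂_Y` and `dy = -ω ∂_X`; `m` stands for the derivative of
the slope `ℓ`, and `hm` is the derivative of `hℓ`. The left-hand side is the derivative of the first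
coordinate of the sum. Being purely algebraic, the identity applies to derivations and to analytic
derivatives alike. -/
theorem addX_tangent {x₁ y₁ x₂ y₂ ω₁ ω₂ ℓ m : K} (h₁ : W.Equation x₁ y₁) (h₂ : W.Equation x₂ y₂)
    (hx : x₁ ≠ x₂) (hℓ : ℓ * (x₁ - x₂) = y₁ - y₂)
    (hm : m * (x₁ - x₂) + ℓ * (ω₁ * partialY W x₁ y₁ - ω₂ * partialY W x₂ y₂) =
      -(ω₁ * partialX W x₁ y₁) + ω₂ * partialX W x₂ y₂) :
    (2 * ℓ + W.a₁) * m - ω₁ * partialY W x₁ y₁ - ω₂ * partialY W x₂ y₂ =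
      (ω₁ + ω₂) * partialY W (W.addX x₁ x₂ ℓ) (W.addY x₁ x₂ y₁ ℓ) := by
  have hu : x₁ - x₂ ≠ 0 := sub_ne_zero.mpr hx
  obtain rfl : y₂ = y₁ - ℓ * (x₁ - x₂) := by rw [hℓ]; ring
  rw [equation_iff] at h₁ h₂
  -- The difference of the two curve equations, divided by `x₁ - x₂`.
  have hR : ℓ * (2 * y₁ - ℓ * (x₁ - x₂)) + W.a₁ * (y₁ + x₂ * ℓ) + W.a₃ * ℓ -
      (x₁ ^ 2 + x₁ * x₂ + x₂ ^ 2 + W.a₂ * (x₁ + x₂) + W.a₄) = 0 := by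
    apply mul_left_cancel₀ hu
    linear_combination h₁ - h₂
  apply mul_left_cancel₀ hu
  simp only [partialX, partialY, addX, addY, negAddY, negY] at hm ⊢
  linear_combination (2 * ℓ + W.a₁) * hm + (2 * ℓ + W.a₁) * (ω₂ - ω₁) * hR

/-- The companion identity for the second coordinate: the left-hand side is the derivative of
`addY`, with the derivative of `addX` written out. -/
theorem addY_tangent {x₁ y₁ x₂ y₂ ω₁ ω₂ ℓ m : K} (h₁ : W.Equation x₁ y₁) (h₂ : W.Equation x₂ y₂)
    (hx : x₁ ≠ x₂) (hℓ : ℓ * (x₁ - x₂) = y₁ - y₂)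
    (hm : m * (x₁ - x₂) + ℓ * (ω₁ * partialY W x₁ y₁ - ω₂ * partialY W x₂ y₂) =
      -(ω₁ * partialX W x₁ y₁) + ω₂ * partialX W x₂ y₂) :
    -(m * (W.addX x₁ x₂ ℓ - x₁) + ℓ * (((2 * ℓ + W.a₁) * m - ω₁ * partialY W x₁ y₁ -
      ω₂ * partialY W x₂ y₂) - ω₁ * partialY W x₁ y₁) - ω₁ * partialX W x₁ y₁) -
      W.a₁ * ((2 * ℓ + W.a₁) * m - ω₁ * partialY W x₁ y₁ - ω₂ * partialY W x₂ y₂) =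
      -((ω₁ + ω₂) * partialX W (W.addX x₁ x₂ ℓ) (W.addY x₁ x₂ y₁ ℓ)) := by
  rw [addX_tangent h₁ h₂ hx hℓ hm]
  have hu : x₁ - x₂ ≠ 0 := sub_ne_zero.mpr hx
  obtain rfl : y₂ = y₁ - ℓ * (x₁ - x₂) := by rw [hℓ]; ring
  rw [equation_iff] at h₁ h₂
  have hR : ℓ * (2 * y₁ - ℓ * (x₁ - x₂)) + W.a₁ * (y₁ + x₂ * ℓ) + W.a₃ * ℓ -
      (x₁ ^ 2 + x₁ * x₂ + x₂ ^ 2 + W.a₂ * (x₁ + x₂) + W.a₄) = 0 := by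
    apply mul_left_cancel₀ hu
    linear_combination h₁ - h₂
  apply mul_left_cancel₀ hu
  simp only [partialX, partialY, addX, addY, negAddY, negY] at hm ⊢
  linear_combination (-(ℓ^2+W.a₁*ℓ-W.a₂-x₁-x₂-x₁)) * hm -
    ((ω₂-ω₁)*(ℓ^2+W.a₁*ℓ-W.a₂)+3*x₂*ω₁-3*x₁*ω₂) * hR

end Tangent

/-! ### Coordinates of points -/

section Coordinates

open WeierstrassCurve.Affine

variable {F : Type*} [Field F] (E : WeierstrassCurve F) {K K' : Type*} [Field K] [Algebra F K]
  [Field K'] [Algebra F K']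

/-- The equation of `E` over an extension field. -/
abbrev curve (K : Type*) [Field K] [Algebra F K] : WeierstrassCurve.Affine K :=
  (E.baseChange K).toAffine

instance [E.IsElliptic] : (E.baseChange K).IsElliptic :=
  inferInstanceAs (E.map (algebraMap F K)).IsElliptic

variable {E}

/-- `P` is the affine point `(x, y)`. -/
def HasCoords (P : Points E K) (x y : K) : Prop :=
  ∃ h : (curve E K).Nonsingular x y, P = Point.some x y h

theorem exists_hasCoords {P : Points E K} (hP : P ≠ 0) : ∃ x y, HasCoords P x y := by
  match P with
  | .zero => exact absurd rfl hP
  | .some x y h => exact ⟨x, y, h, rfl⟩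

theorem HasCoords.ne_zero {P : Points E K} {x y : K} (h : HasCoords P x y) : P ≠ 0 := by
  obtain ⟨h, rfl⟩ := h
  exact Point.some_ne_zero h

theorem HasCoords.equation {P : Points E K} {x y : K} (h : HasCoords P x y) :
    (curve E K).Equation x y := h.1.1

theorem HasCoords.eq {P Q : Points E K} {x y : K} (hP : HasCoords P x y) (hQ : HasCoords Q x y) :
    P = Q := by
  obtain ⟨h, rfl⟩ := hP
  obtain ⟨h', rfl⟩ := hQ
  rfl

theorem HasCoords.unique {P : Points E K} {x y x' y' : K} (h : HasCoords P x y)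
    (h' : HasCoords P x' y') : x = x' ∧ y = y' := by
  obtain ⟨h, rfl⟩ := h
  obtain ⟨h', e⟩ := h'
  exact (Point.some.injEq _ _ _ _ _ _).mp e

theorem HasCoords.map (f : K →ₐ[F] K') {P : Points E K} {x y : K} (h : HasCoords P x y) :
    HasCoords (Points.map E f P) (f x) (f y) := by
  obtain ⟨h, rfl⟩ := h
  exact ⟨(baseChange_nonsingular (W := E) (f := f) f.injective x y).mpr h, rfl⟩

theorem Points.map_injective (f : K →ₐ[F] K') : Function.Injective (Points.map E f) := by
  classical
  exact Point.map_injective (W' := E) (f := f)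

theorem exists_map_eq_of_hasCoords (f : K →ₐ[F] K') {P : Points E K'} {x y : K}
    (h : HasCoords P (f x) (f y)) : ∃ P', Points.map E f P' = P := by
  obtain ⟨h, rfl⟩ := h
  exact ⟨Point.some x y ((baseChange_nonsingular (W := E) (f := f) f.injective x y).mp h), rfl⟩

theorem exists_point_of_equation [E.IsElliptic] {x y : K} (h : (curve E K).Equation x y) :
    ∃ P : Points E K, HasCoords P x y :=
  ⟨Point.some x y (equation_iff_nonsingular.mp h), _, rfl⟩

theorem HasCoords.x_ne {P Q : Points E K} {x₁ y₁ x₂ y₂ : K} (hP : HasCoords P x₁ y₁)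
    (hQ : HasCoords Q x₂ y₂) (h : P ≠ Q) (h' : P ≠ -Q) : x₁ ≠ x₂ := by
  obtain ⟨hP', rfl⟩ := hP
  obtain ⟨hQ', rfl⟩ := hQ
  rintro rfl
  classical
  rcases Y_eq_of_X_eq hP'.1 hQ'.1 rfl with rfl | rfl
  · exact h rfl
  · exact h' rfl

theorem HasCoords.neg {P : Points E K} {x y : K} (hP : HasCoords P x y) :
    HasCoords (-P) x ((curve E K).negY x y) := by
  obtain ⟨hP', rfl⟩ := hP
  exact ⟨(nonsingular_neg ..).mpr hP', rfl⟩

theorem HasCoords.add {P Q : Points E K} {x₁ y₁ x₂ y₂ : K} (hP : HasCoords P x₁ y₁)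
    (hQ : HasCoords Q x₂ y₂) (hx : x₁ ≠ x₂) :
    HasCoords (P + Q) ((curve E K).addX x₁ x₂ ((y₁ - y₂) / (x₁ - x₂)))
      ((curve E K).addY x₁ x₂ y₁ ((y₁ - y₂) / (x₁ - x₂))) := by
  let _ := Classical.decEq K
  obtain ⟨hP', rfl⟩ := hP
  obtain ⟨hQ', rfl⟩ := hQ
  have h := nonsingular_add hP' hQ' fun h => hx h.1
  rw [slope_of_X_ne hx] at h
  refine ⟨h, ?_⟩
  have := Point.add_of_X_ne (h₁ := hP') (h₂ := hQ') hx
  simp only [slope_of_X_ne hx] at this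
  exact this

theorem partial_ne_zero {P : Points E K} {x y : K} (hP : HasCoords P x y) :
    partialX (curve E K) x y ≠ 0 ∨ partialY (curve E K) x y ≠ 0 := by
  obtain ⟨⟨-, h⟩, -⟩ := hP
  rw [evalEval_polynomialX, evalEval_polynomialY] at h
  refine h.imp (fun h h' => h ?_) id
  rw [← h', partialX]
  ring

theorem partialY_sq {x y : K} (h : (curve E K).Equation x y) :
    partialY (curve E K) x y ^ 2 = (curve E K).twoTorsionPolynomial.toPoly.eval x := by
  rw [equation_iff] at h
  simp only [partialY, WeierstrassCurve.twoTorsionPolynomial, Cubic.toPoly, WeierstrassCurve.b₂,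
    WeierstrassCurve.b₄, WeierstrassCurve.b₆, Polynomial.eval_add, Polynomial.eval_mul,
    Polynomial.eval_C, Polynomial.eval_pow, Polynomial.eval_X]
  linear_combination 4 * h

/-- In characteristic two the leading coefficient `4` is zero, so ellipticity is needed: if `b₂` and
`b₆` vanished too, the discriminant would be zero. -/
theorem twoTorsionPolynomial_toPoly_ne_zero [E.IsElliptic] :
    (curve E K).twoTorsionPolynomial.toPoly ≠ 0 := by
  intro h
  have h0 := Cubic.toPoly_eq_zero_iff _ |>.mp h
  rw [Cubic.ext_iff] at h0
  obtain ⟨h4, hb2, -, hb6⟩ := h0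
  simp only [WeierstrassCurve.twoTorsionPolynomial] at h4 hb2 hb6
  change (4 : K) = 0 at h4
  change (curve E K).b₂ = 0 at hb2
  change (curve E K).b₆ = 0 at hb6
  refine (E.baseChange K).isUnit_Δ.ne_zero ?_
  have h8 : (8 : K) = 0 := by linear_combination 2 * h4
  rw [WeierstrassCurve.Δ, hb2, hb6, h8]
  ring

/-- These are the affine points of order two. Their first coordinates are roots of a nonzero
polynomial, and each is its own negative, so the first coordinate determines it. -/
theorem finite_setOf_partialY_eq_zero [E.IsElliptic] :
    {P : Points E K | ∃ x y, HasCoords P x y ∧ partialY (curve E K) x y = 0}.Finite := by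
  have hfin : {x : K | (curve E K).twoTorsionPolynomial.toPoly.eval x = 0}.Finite :=
    Polynomial.finite_setOfPred_isRoot twoTorsionPolynomial_toPoly_ne_zero
  choose! x y hxy using fun (P : Points E K)
    (h : P ∈ {P : Points E K | ∃ x y, HasCoords P x y ∧ partialY (curve E K) x y = 0}) => h
  refine Set.Finite.of_finite_image (f := x) (hfin.subset ?_) ?_
  · rintro _ ⟨P, hP, rfl⟩
    change _ = _
    rw [← partialY_sq (hxy P hP).1.equation, (hxy P hP).2, zero_pow two_ne_zero]
  · intro P hP Q hQ e
    by_contra hne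
    refine (hxy P hP).1.x_ne (hxy Q hQ).1 hne (fun h => hne ?_) e
    have h1 := (hxy Q hQ).1.neg
    have h2 : (curve E K).negY (x Q) (y Q) = y Q := by
      have := (hxy Q hQ).2
      rw [partialY] at this
      rw [negY]
      linear_combination -this
    rw [h2] at h1
    rw [h, h1.eq (hxy Q hQ).1]

theorem infinite_points_of_isSepClosed [E.IsElliptic] [IsSepClosed K] [Infinite K] :
    Infinite (Points E K) := by
  have hfin : {x : K | (curve E K).twoTorsionPolynomial.toPoly.eval x = 0}.Finite :=
    Polynomial.finite_setOfPred_isRoot twoTorsionPolynomial_toPoly_ne_zero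
  have key : ∀ x : K, (curve E K).twoTorsionPolynomial.toPoly.eval x ≠ 0 →
      ∃ (P : Points E K) (y : K), HasCoords P x y := by
    intro x hx
    set b := (curve E K).a₁ * x + (curve E K).a₃ with hb
    set e := x ^ 3 + (curve E K).a₂ * x ^ 2 + (curve E K).a₄ * x + (curve E K).a₆ with he
    have hdisc : (curve E K).twoTorsionPolynomial.toPoly.eval x = b ^ 2 + 4 * e := by
      simp only [WeierstrassCurve.twoTorsionPolynomial, Cubic.toPoly, WeierstrassCurve.b₂,
        WeierstrassCurve.b₄, WeierstrassCurve.b₆, Polynomial.eval_add, Polynomial.eval_mul,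
        Polynomial.eval_C, Polynomial.eval_pow, Polynomial.eval_X, hb, he]
      ring
    obtain ⟨y, hy⟩ : ∃ y, y ^ 2 + b * y = e := by
      -- The quadratic in `y` has nonzero discriminant. In characteristic two this means `b ≠ 0`,
      -- which makes it separable; otherwise one completes the square.
      rcases eq_or_ne (2 : K) 0 with h2 | h2
      · have hb0 : b ≠ 0 := by
          intro h
          refine hx ?_
          rw [hdisc, h]
          linear_combination 2 * e * h2
        obtain ⟨y, hy⟩ := IsSepClosed.exists_root_C_mul_X_pow_add_C_mul_X_add_C 1 b (-e)
          (n := 2) (by exact_mod_cast h2) le_rfl hb0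
        exact ⟨y, by linear_combination hy⟩
      · have : NeZero (2 : K) := ⟨h2⟩
        obtain ⟨z, hz⟩ := IsSepClosed.exists_eq_mul_self (b ^ 2 + 4 * e)
        refine ⟨(z - b) / 2, ?_⟩
        field_simp
        linear_combination -hz
    obtain ⟨P, hP⟩ := exists_point_of_equation (E := E) (K := K) (x := x) (y := y)
      ((equation_iff _ _).mpr (by linear_combination hy))
    exact ⟨P, y, hP⟩
  choose! P y hP using key
  have hinf : Infinite ↥({x : K | (curve E K).twoTorsionPolynomial.toPoly.eval x = 0}ᶜ) :=
    hfin.infinite_compl.to_subtype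
  refine Infinite.of_injective (fun x : ↥({x : K | (curve E K).twoTorsionPolynomial.toPoly.eval x = 0}ᶜ) => P x) ?_
  intro a b hab
  have h1 := hP a a.2
  have h2 := hP b b.2
  simp only at hab
  rw [hab] at h1
  exact Subtype.ext (h1.unique h2).1

end Coordinates

/-! ### Multiples of a moving point -/

section Chain

/-- Multiplication by `n` scales tangent vectors by `n`. The chord law fails when two points agree
or are opposite, so `n • P` cannot be reached directly. Adding constants `i c`, whose tangent is
zero, changes no tangent and steers clear of any finite set of bad positions. `A` holds moving
points, `ev` their positions, `C` the constants. -/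
theorem exists_chain {A B C K : Type*} [AddCommGroup A] [AddCommGroup B] [AddCommGroup C] [Field K]
    [Infinite C] (ev : A →+ B) (i : C →+ A) (hi : Function.Injective (ev.comp i))
    (Tan : A → K → Prop)
    (hadd : ∀ P Q ω ω', Tan P ω → Tan Q ω' → ev P ≠ ev Q → ev P ≠ -ev Q → Tan (P + Q) (ω + ω'))
    (hconst : ∀ c ≠ 0, Tan (i c) 0) {P : A} {ω : K} (hP : Tan P ω) (n : ℕ) (hn : n ≠ 0)
    {s : Set B} (hs : s.Finite) :
    ∃ c, Tan (n • P + i c) (n • ω) ∧ ev (n • P + i c) ∉ s := by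
  have avoid : ∀ t : Set B, t.Finite → ∃ c, ev (i c) ∉ t := fun t ht => by
    obtain ⟨c, hc⟩ := (ht.preimage hi.injOn).infinite_compl.nonempty
    exact ⟨c, hc⟩
  have shift : ∀ (Q : A) (ω' : K), Tan Q ω' → ∀ t : Set B, t.Finite →
      ∃ c, Tan (Q + i c) ω' ∧ ev (Q + i c) ∉ t := fun Q ω' hQ t ht => by
    -- The first three exclusions make the chord law applicable to `Q` and `i c`; the translate of
    -- `t` keeps the sum off `t`.
    obtain ⟨c, hc⟩ := avoid ({0, ev Q, -ev Q} ∪ (fun b => b - ev Q) '' t)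
      ((Set.toFinite _).union (ht.image _))
    simp only [Set.mem_union, Set.mem_insert_iff, Set.mem_singleton_iff, not_or] at hc
    obtain ⟨⟨h0, h1, h2⟩, h3⟩ := hc
    refine ⟨c, ?_, fun h => h3 ⟨_, h, by simp⟩⟩
    have := hadd Q (i c) ω' 0 hQ (hconst c fun h => h0 (by simp [h])) (fun h => h1 h.symm)
      fun h => h2 (by rw [h, neg_neg])
    rwa [add_zero] at this
  suffices ∃ c, Tan (n • P + i c) (n • ω) by
    obtain ⟨c, hc⟩ := this
    obtain ⟨d, hd, hd'⟩ := shift _ _ hc s hs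
    exact ⟨c + d, by rwa [i.map_add, ← add_assoc], by rwa [i.map_add, ← add_assoc]⟩
  induction n with
  | zero => exact absurd rfl hn
  | succ n ih =>
    rcases eq_or_ne n 0 with rfl | hn'
    · exact ⟨0, by simpa using hP⟩
    obtain ⟨c, hc⟩ := ih hn'
    obtain ⟨d, hd, hd'⟩ := shift _ _ hc {ev P, -ev P} (Set.toFinite _)
    simp only [Set.mem_insert_iff, Set.mem_singleton_iff, not_or] at hd'
    refine ⟨c + d, ?_⟩
    have := hadd _ _ _ _ hd hP hd'.1 hd'.2
    rw [succ_nsmul, succ_nsmul, map_add]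
    convert this using 1
    abel

end Chain

/-! ### Division of points over a separably closed field -/

section Division

open WeierstrassCurve.Affine

/-- Multiplication by `n` is unramified. A derivation over `S` is a tangent vector `ω` at `Q`; it
induces `n • ω` at a translate of `n • Q` by an `S`-point. That translate is itself an `S`-point,
whose coordinates `D` kills. -/
theorem derivation_eq_zero_of_nsmul {F S K : Type*} [Field F] [Field S] [Field K] [Algebra F S]
    [Algebra F K] [Algebra S K] [IsScalarTower F S K] [IsSepClosed S] [Infinite S]
    {E : WeierstrassCurve F} [E.IsElliptic] (D : Derivation S K K) {n : ℕ} (hn : (n : K) ≠ 0)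
    {Q : Points E K} {P : Points E S} (h : n • Q = Points.map E (IsScalarTower.toAlgHom F S K) P)
    {x y : K} (hQ : HasCoords Q x y) : D x = 0 ∧ D y = 0 := by
  have : Infinite (Points E S) := infinite_points_of_isSepClosed
  let Tan : Points E K → K → Prop := fun R ω => ∃ x y, HasCoords R x y ∧
    D x = ω * partialY (curve E K) x y ∧ D y = -(ω * partialX (curve E K) x y)
  have ha : ∀ a : F, D (algebraMap F K a) = 0 := fun a => by
    rw [IsScalarTower.algebraMap_apply F S K]
    exact D.map_algebraMap _
  have ha₁ : D (curve E K).a₁ = 0 := ha _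
  have ha₂ : D (curve E K).a₂ = 0 := ha _
  have ha₃ : D (curve E K).a₃ = 0 := ha _
  have ha₄ : D (curve E K).a₄ = 0 := ha _
  have ha₆ : D (curve E K).a₆ = 0 := ha _
  have hrel : D x * partialX (curve E K) x y + D y * partialY (curve E K) x y = 0 := by
    have h1 := congrArg D ((equation_iff _ _).mp hQ.equation)
    simp only [map_add, Derivation.leibniz, Derivation.leibniz_pow, ha₁, ha₂, ha₃, ha₄, ha₆,
      smul_eq_mul, nsmul_eq_mul] at h1
    simp only [partialX, partialY]
    push_cast at h1
    linear_combination h1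
  -- By `hrel` the vector `(D x, D y)` is orthogonal to the gradient; nonsingularity allows division
  -- by one of the partial derivatives.
  obtain ⟨ω, hω⟩ : ∃ ω, Tan Q ω := by
    rcases partial_ne_zero hQ with h0 | h0
    · refine ⟨-D y / partialX (curve E K) x y, x, y, hQ, ?_, ?_⟩
      · field_simp
        linear_combination hrel
      · field_simp
    · refine ⟨D x / partialY (curve E K) x y, x, y, hQ, ?_, ?_⟩
      · field_simp
      · field_simp
        linear_combination hrel
  have hconst : ∀ c : Points E S, c ≠ 0 →
      Tan (Points.map E (IsScalarTower.toAlgHom F S K) c) 0 := fun c hc => by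
    obtain ⟨a, b, hab⟩ := exists_hasCoords hc
    refine ⟨_, _, hab.map _, ?_, ?_⟩
    · rw [zero_mul]
      exact D.map_algebraMap a
    · rw [zero_mul, neg_zero]
      exact D.map_algebraMap b
  have hadd : ∀ R R' ω ω', Tan R ω → Tan R' ω' → R ≠ R' → R ≠ -R' → Tan (R + R') (ω + ω') := by
    rintro R R' ω ω' ⟨x₁, y₁, h₁, hx₁, hy₁⟩ ⟨x₂, y₂, h₂, hx₂, hy₂⟩ hne hne'
    have hx := h₁.x_ne h₂ hne hne'
    have hu := sub_ne_zero.mpr hx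
    set ℓ := (y₁ - y₂) / (x₁ - x₂) with hℓ
    have hℓ' : ℓ * (x₁ - x₂) = y₁ - y₂ := by rw [hℓ]; field_simp
    have hm : D ℓ * (x₁ - x₂) + ℓ * (ω * partialY (curve E K) x₁ y₁ -
        ω' * partialY (curve E K) x₂ y₂) =
        -(ω * partialX (curve E K) x₁ y₁) + ω' * partialX (curve E K) x₂ y₂ := by
      have := congrArg D hℓ'
      simp only [Derivation.leibniz, map_sub, hx₁, hx₂, hy₁, hy₂, smul_eq_mul] at this
      linear_combination this
    have e1 := addX_tangent h₁.equation h₂.equation hx hℓ' hm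
    have e2 := addY_tangent h₁.equation h₂.equation hx hℓ' hm
    refine ⟨_, _, h₁.add h₂ hx, ?_, ?_⟩
    · rw [← e1]
      simp only [addX, map_add, map_sub, Derivation.leibniz, Derivation.leibniz_pow, ha₁, ha₂,
        smul_eq_mul, nsmul_eq_mul, hx₁, hx₂]
      push_cast
      ring
    · rw [← e2]
      simp only [addY, negAddY, negY, addX, map_add, map_sub, map_neg, Derivation.leibniz,
        Derivation.leibniz_pow, ha₁, ha₂, ha₃, smul_eq_mul, nsmul_eq_mul, hx₁, hx₂, hy₁]
      push_cast
      ring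
  obtain ⟨c, ⟨a, b, hab, ha', hb'⟩, h0⟩ := exists_chain (AddMonoidHom.id (Points E K))
    (Points.map E (IsScalarTower.toAlgHom F S K)) (Points.map_injective _) Tan
    hadd hconst hω n (fun h => hn (by simp [h])) (Set.finite_singleton 0)
  have hzero : n • ω = 0 := by
    rw [h, ← map_add] at hab
    have hc : P + c ≠ 0 := fun h' => hab.ne_zero (by rw [h', map_zero])
    obtain ⟨a', b', hab'⟩ := exists_hasCoords hc
    obtain ⟨rfl, rfl⟩ := hab.unique (hab'.map _)
    have hDa : D (IsScalarTower.toAlgHom F S K a') = 0 := D.map_algebraMap a'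
    have hDb : D (IsScalarTower.toAlgHom F S K b') = 0 := D.map_algebraMap b'
    rw [hDa] at ha'
    rw [hDb] at hb'
    rcases partial_ne_zero hab with hp | hp
    · exact (mul_eq_zero.mp (neg_eq_zero.mp hb'.symm)).resolve_right hp
    · exact (mul_eq_zero.mp ha'.symm).resolve_right hp
  have hω0 : ω = 0 := by simpa [hn] using hzero
  obtain ⟨x', y', hQ', hx', hy'⟩ := hω
  obtain ⟨rfl, rfl⟩ := hQ.unique hQ'
  rw [hx', hy', hω0]
  simp

open IntermediateField in
/-- Over a separably closed field, division by an integer that is not divisible by the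
characteristic does not lead to larger fields. -/
theorem exists_map_eq_of_nsmul {F S Ω : Type*} [Field F] [Field S] [Field Ω] [Algebra F S]
    [Algebra F Ω] [IsSepClosed S] [Infinite S]
    {E : WeierstrassCurve F} [E.IsElliptic] (f : S →ₐ[F] Ω) {n : ℕ} (hn : (n : Ω) ≠ 0)
    {Q : Points E Ω} {P : Points E S} (h : n • Q = Points.map E f P) :
    ∃ Q', Points.map E f Q' = Q := by
  rcases eq_or_ne Q 0 with rfl | hQ0
  · exact ⟨0, map_zero _⟩
  obtain ⟨x, y, hQ⟩ := exists_hasCoords hQ0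
  let _ : Algebra S Ω := f.toRingHom.toAlgebra
  have _ : IsScalarTower F S Ω := IsScalarTower.of_algebraMap_eq fun x => (f.commutes x).symm
  let K : IntermediateField S Ω := adjoin S {x, y}
  let g : K →ₐ[F] Ω := K.val.restrictScalars F
  let x' : K := ⟨x, subset_adjoin _ _ (by simp)⟩
  let y' : K := ⟨y, subset_adjoin _ _ (by simp)⟩
  obtain ⟨Q', rfl⟩ := exists_map_eq_of_hasCoords g (x := x') (y := y') hQ
  have hQ' : HasCoords Q' x' y' := by
    obtain ⟨a, b, hab⟩ := exists_hasCoords (P := Q') (fun h => hQ0 (by rw [h, map_zero]))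
    obtain ⟨h1, h2⟩ := hQ.unique (hab.map g)
    rwa [show x' = a from g.injective h1, show y' = b from g.injective h2]
  have hn' : (n : K) ≠ 0 := fun h => hn (by simpa using congrArg g h)
  have hn2 : n • Q' = Points.map E (IsScalarTower.toAlgHom F S K) P := by
    apply Points.map_injective g
    rw [map_nsmul, h, Points.map_map]
    rfl
  -- Derivations of `K = S(x, y)` over `S` are determined on `x` and `y`, so all vanish. Hence `K`
  -- is unramified over `S`, therefore separable algebraic, therefore equal to `S`.
  have hD : ∀ D : Derivation S K K, D = 0 := fun D => by
    obtain ⟨hx, hy⟩ := derivation_eq_zero_of_nsmul D hn' hn2 hQ'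
    refine Derivation.ext fun ⟨z, hz⟩ => ?_
    change D ⟨z, hz⟩ = 0
    induction hz using adjoin_induction with
    | mem z hz =>
      rcases hz with rfl | rfl
      · exact hx
      · exact hy
    | algebraMap a => exact D.map_algebraMap a
    | add a b ha hb iha ihb =>
      have := D.map_add ⟨a, ha⟩ ⟨b, hb⟩
      rwa [iha, ihb, add_zero] at this
    | inv a ha iha =>
      have := D.leibniz_inv ⟨a, ha⟩
      rwa [iha, smul_zero] at this
    | mul a b ha hb iha ihb =>
      have := D.leibniz ⟨a, ha⟩ ⟨b, hb⟩
      rwa [iha, ihb, smul_zero, smul_zero, add_zero] at this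
  have hess : Algebra.EssFiniteType S K :=
    IntermediateField.essFiniteType_iff.mpr (fg_adjoin_of_finite (Set.toFinite _))
  have hunr : Algebra.FormallyUnramified S K := by
    refine ⟨?_⟩
    rw [← Module.subsingleton_dual_iff K]
    refine (KaehlerDifferential.linearMapEquivDerivation S K (M := K)).toEquiv.subsingleton_congr.mpr ?_
    exact ⟨fun a b => by rw [hD a, hD b]⟩
  have hsep : Algebra.IsSeparable S K := Algebra.FormallyUnramified.isSeparable S K
  obtain ⟨a, ha⟩ := IsSepClosed.algebraMap_surjective S K x'
  obtain ⟨b, hb⟩ := IsSepClosed.algebraMap_surjective S K y'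
  refine exists_map_eq_of_hasCoords f (x := a) (y := b) ?_
  have h1 : f a = x := congrArg g ha
  have h2 : f b = y := congrArg g hb
  rwa [h1, h2]

end Division

/-! ### Galois action on points and the Kummer image -/

section GaloisPoints

open Topology

variable {F : Type*} [Field F] {E : WeierstrassCurve F} {K Ω : Type*} [Field K] [Field Ω]
  [Algebra F K] [Algebra F Ω] [Algebra K Ω] [IsScalarTower F K Ω]

theorem HasCoords.smul {P : Points E Ω} {x y : Ω} (h : HasCoords P x y) (σ : Gal(Ω/K)) :
    HasCoords (σ • P) (σ x) (σ y) :=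
  h.map (σ.toAlgHom.restrictScalars F)

theorem isLocallyConstant_smul [Algebra.IsIntegral K Ω] (P : Points E Ω) :
    IsLocallyConstant fun σ : Gal(Ω/K) => σ • P := by
  rcases eq_or_ne P 0 with rfl | hP
  · simp only [smul_zero]
    exact IsLocallyConstant.const 0
  obtain ⟨x, y, h⟩ := exists_hasCoords hP
  refine isLocallyConstant_of_mul_right
    (MulAction.stabilizer Gal(Ω/K) x ⊓ MulAction.stabilizer Gal(Ω/K) y)
    ((stabilizer_isOpen_of_isIntegral x).inter (stabilizer_isOpen_of_isIntegral y)) ?_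
  rintro σ τ ⟨hx, hy⟩
  have hx' : τ x = x := hx
  have hy' : τ y = y := hy
  have := h.smul τ
  rw [hx', hy'] at this
  rw [mul_smul, this.eq h]

theorem isLocallyConstant_smul_torsion [Algebra.IsIntegral K Ω] {r : ℕ} (P : torsion E r Ω) :
    IsLocallyConstant fun σ : Gal(Ω/K) => σ • P :=
  (isLocallyConstant_smul (K := K) P.1).desc (fun σ => σ • P) Subtype.val Subtype.val_injective

theorem exists_map_eq_of_fixed [IsGalois K Ω] {P : Points E Ω} (h : ∀ σ : Gal(Ω/K), σ • P = P) :
    ∃ P', Points.map E (IsScalarTower.toAlgHom F K Ω) P' = P := by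
  rcases eq_or_ne P 0 with rfl | hP
  · exact ⟨0, map_zero _⟩
  obtain ⟨x, y, hxy⟩ := exists_hasCoords hP
  have hfix : ∀ σ : Gal(Ω/K), σ x = x ∧ σ y = y := fun σ =>
    (h σ ▸ hxy.smul σ).unique hxy
  obtain ⟨a, rfl⟩ := (InfiniteGalois.mem_range_algebraMap_iff_fixed x).mpr fun σ => (hfix σ).1
  obtain ⟨b, rfl⟩ := (InfiniteGalois.mem_range_algebraMap_iff_fixed y).mpr fun σ => (hfix σ).2
  exact exists_map_eq_of_hasCoords (IsScalarTower.toAlgHom F K Ω) hxy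

theorem smul_map_base (σ : Gal(Ω/K)) (P : Points E K) :
    σ • Points.map E (IsScalarTower.toAlgHom F K Ω) P =
      Points.map E (IsScalarTower.toAlgHom F K Ω) P := by
  change Points.map E _ (Points.map E _ P) = _
  rw [Points.map_map]
  congr 2
  exact AlgHom.ext fun x => σ.commutes x

end GaloisPoints

/-! ### Equality of cohomology classes in terms of cocycles. -/

section Cocycles

variable {G M : Type*} [Group G] [TopologicalSpace G] [AddCommGroup M] [DistribMulAction G M]

theorem H1.mk_eq_mk_iff {c c' : Z1 G M} :
    H1.mk c = H1.mk c' ↔ ∃ m : M, ∀ σ, c'.1 σ = c.1 σ + (σ • m - m) := by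
  refine QuotientAddGroup.eq.trans (exists_congr fun m => forall_congr' fun σ => ?_)
  change -c.1 σ + c'.1 σ = _ ↔ _
  rw [neg_add_eq_iff_eq_add]

theorem H1.exists_mk (x : H1 G M) : ∃ c, H1.mk c = x := QuotientAddGroup.mk_surjective x

end Cocycles

section Kummer

variable {F : Type*} [Field F] {E : WeierstrassCurve F} {r : ℕ} {K : Type*} [Field K] [Algebra F K]

/-- The values of `c` have a common exponent `r ^ k`, so `r ^ k • Q` is Galois invariant. -/
theorem exists_pow_nsmul_eq_map (c : Z1 Gal(SepClosure K/K) (torsion E r (SepClosure K)))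
    {Q : Points E (SepClosure K)}
    (hQ : ∀ σ : Gal(SepClosure K/K), (c.1 σ : Points E (SepClosure K)) = σ • Q - Q) :
    ∃ (k : ℕ) (P : Points E K),
      r ^ k • Q = Points.map E (IsScalarTower.toAlgHom F K (SepClosure K)) P := by
  obtain ⟨k, hk⟩ := exists_pow_smul_eq_zero (r := r) c.1 c.2.1 fun σ => by
    obtain ⟨k, hk⟩ := (c.1 σ).2
    exact ⟨k, Subtype.ext hk⟩
  have hfix : ∀ σ : Gal(SepClosure K/K), σ • (r ^ k • Q) = r ^ k • Q := fun σ => by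
    have h1 : r ^ k • (c.1 σ : Points E (SepClosure K)) = 0 := congrArg Subtype.val (hk σ)
    rw [hQ, smul_sub, sub_eq_zero] at h1
    rw [smul_comm]
    exact h1
  obtain ⟨P, hP⟩ := exists_map_eq_of_fixed hfix
  exact ⟨k, P, hP.symm⟩

/-- The Kummer image is the kernel of the passage to `H¹(K, E)`. Rationality of a multiple of `Q` is
automatic, so it drops out of the condition. -/
theorem mk_mem_kummerImage_iff (c : Z1 Gal(SepClosure K/K) (torsion E r (SepClosure K))) :
    H1.mk c ∈ kummerImage E r K ↔ ∃ Q : Points E (SepClosure K),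
      ∀ σ : Gal(SepClosure K/K), (c.1 σ : Points E (SepClosure K)) = σ • Q - Q := by
  constructor
  · rintro ⟨c', h, P, k, Q, -, hQ⟩
    obtain ⟨m, hm⟩ := H1.mk_eq_mk_iff.mp h
    refine ⟨Q + m, fun σ => ?_⟩
    rw [hm]
    have : ((c'.1 σ + (σ • m - m) : torsion E r (SepClosure K)) : Points E (SepClosure K)) =
      c'.1 σ + (σ • (m : Points E (SepClosure K)) - m) := rfl
    rw [this, hQ, smul_add]
    abel
  · rintro ⟨Q, hQ⟩
    obtain ⟨k, P, hP⟩ := exists_pow_nsmul_eq_map c hQ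
    exact ⟨c, rfl, P, k, Q, hP, hQ⟩

end Kummer

/-! ### Points over complete fields -/

section Germs

open Topology Filter WeierstrassCurve.Affine

variable {F : Type*} [Field F] {E : WeierstrassCurve F} {M : Type*} [NontriviallyNormedField M]
  [Algebra F M]

/-- The family of points `P` has the tangent vector `ω` at `t₀`. -/
def HasTangent (t₀ : M) (P : M → Points E M) (ω : M) : Prop :=
  ∃ X Y : M → M, HasStrictDerivAt X (ω * partialY (curve E M) (X t₀) (Y t₀)) t₀ ∧
    HasStrictDerivAt Y (-(ω * partialX (curve E M) (X t₀) (Y t₀))) t₀ ∧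
    ∀ᶠ t in 𝓝 t₀, HasCoords (P t) (X t) (Y t)

theorem hasTangent_const (t₀ : M) {P : Points E M} (hP : P ≠ 0) :
    HasTangent t₀ (fun _ => P) 0 := by
  obtain ⟨x, y, h⟩ := exists_hasCoords hP
  exact ⟨fun _ => x, fun _ => y, by simpa using hasStrictDerivAt_const t₀ x,
    by simpa using hasStrictDerivAt_const t₀ y, .of_forall fun _ => h⟩

theorem HasTangent.add {t₀ : M} {P Q : M → Points E M} {ω ω' : M} (hP : HasTangent t₀ P ω)
    (hQ : HasTangent t₀ Q ω') (hne : P t₀ ≠ Q t₀) (hne' : P t₀ ≠ -Q t₀) :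
    HasTangent t₀ (P + Q) (ω + ω') := by
  obtain ⟨X₁, Y₁, hX₁, hY₁, h₁⟩ := hP
  obtain ⟨X₂, Y₂, hX₂, hY₂, h₂⟩ := hQ
  have c₁ := h₁.self_of_nhds
  have c₂ := h₂.self_of_nhds
  have hx := c₁.x_ne c₂ hne hne'
  have hu := sub_ne_zero.mpr hx
  have hℓd := (hY₁.sub hY₂).div (hX₁.sub hX₂) hu
  set ℓ : M → M := fun t => (Y₁ t - Y₂ t) / (X₁ t - X₂ t) with hℓdef
  set m := ((-(ω * partialX (curve E M) (X₁ t₀) (Y₁ t₀)) -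
    -(ω' * partialX (curve E M) (X₂ t₀) (Y₂ t₀))) * (X₁ - X₂) t₀ - (Y₁ - Y₂) t₀ *
    (ω * partialY (curve E M) (X₁ t₀) (Y₁ t₀) - ω' * partialY (curve E M) (X₂ t₀) (Y₂ t₀))) /
    (X₁ - X₂) t₀ ^ 2 with hmdef
  have hℓ : HasStrictDerivAt ℓ m t₀ := hℓd
  have hℓ' : ℓ t₀ * (X₁ t₀ - X₂ t₀) = Y₁ t₀ - Y₂ t₀ := by simp only [hℓdef]; field_simp
  have hm : m * (X₁ t₀ - X₂ t₀) + ℓ t₀ * (ω * partialY (curve E M) (X₁ t₀) (Y₁ t₀) -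
      ω' * partialY (curve E M) (X₂ t₀) (Y₂ t₀)) =
      -(ω * partialX (curve E M) (X₁ t₀) (Y₁ t₀)) +
        ω' * partialX (curve E M) (X₂ t₀) (Y₂ t₀) := by
    simp only [hmdef, hℓdef, Pi.sub_apply]
    field_simp
    ring
  have e1 := addX_tangent c₁.equation c₂.equation hx hℓ' hm
  have e2 := addY_tangent c₁.equation c₂.equation hx hℓ' hm
  have hX₃ : HasStrictDerivAt (fun t => (curve E M).addX (X₁ t) (X₂ t) (ℓ t))
      ((ω + ω') * partialY (curve E M) ((curve E M).addX (X₁ t₀) (X₂ t₀) (ℓ t₀))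
        ((curve E M).addY (X₁ t₀) (X₂ t₀) (Y₁ t₀) (ℓ t₀))) t₀ := by
    rw [← e1]
    refine HasStrictDerivAt.congr_deriv (((((hℓ.pow 2).add (hℓ.const_mul
      (curve E M).a₁)).sub_const (curve E M).a₂).sub hX₁).sub hX₂) ?_
    push_cast
    ring
  refine ⟨_, fun t => (curve E M).addY (X₁ t) (X₂ t) (Y₁ t) (ℓ t), hX₃, ?_, ?_⟩
  · rw [← e1] at hX₃
    rw [← e2]
    refine HasStrictDerivAt.congr_deriv ((((hℓ.mul (hX₃.sub hX₁)).add hY₁).neg.sub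
      (hX₃.const_mul (curve E M).a₁)).sub_const (curve E M).a₃) ?_
    simp only [Pi.sub_apply]
    ring
  · have hev : ∀ᶠ t in 𝓝 t₀, X₁ t - X₂ t ≠ 0 :=
      (hX₁.sub hX₂).hasDerivAt.continuousAt.eventually_ne hu
    filter_upwards [h₁, h₂, hev] with t k₁ k₂ k₃
    exact k₁.add k₂ (sub_ne_zero.mp k₃)

variable [CompleteSpace M]

/-- The first coordinate is a local parameter where `∂_Y ≠ 0`. Substituting `y = y₀ + b s` turns the
curve equation into `s² + s = e / b²`, so inverting `s² + s` near `0` suffices, in every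
characteristic. -/
theorem exists_germ {x₀ y₀ : M} (h : (curve E M).Equation x₀ y₀)
    (hY : partialY (curve E M) x₀ y₀ ≠ 0) :
    ∃ (Y : M → M) (Y' : M), HasStrictDerivAt Y Y' x₀ ∧ Y x₀ = y₀ ∧
      ∀ᶠ t in 𝓝 x₀, (curve E M).Equation t (Y t) := by
  have hq : HasStrictDerivAt (fun s : M => s ^ 2 + s) 1 0 := by
    refine HasStrictDerivAt.congr_deriv
      (((hasStrictDerivAt_id (0 : M)).pow 2).add (hasStrictDerivAt_id (0 : M))) ?_
    simp
  have hq0 : (0 : M) ^ 2 + 0 = 0 := by simp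
  set φ := hq.localInverse _ _ _ one_ne_zero with hφ
  have hφ0 : φ 0 = 0 := by
    have := HasStrictFDerivAt.localInverse_apply_image (hq.hasStrictFDerivAt_equiv one_ne_zero)
    rwa [hq0] at this
  have hφd : HasStrictDerivAt φ 1⁻¹ 0 := by
    have := hq.to_localInverse one_ne_zero
    rwa [hq0] at this
  have hφi : ∀ᶠ u in 𝓝 (0 : M), φ u ^ 2 + φ u = u := by
    have := HasStrictFDerivAt.eventually_right_inverse (hq.hasStrictFDerivAt_equiv one_ne_zero)
    rwa [hq0] at this
  set W := curve E M
  let b : M → M := fun t => 2 * y₀ + W.a₁ * t + W.a₃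
  let e : M → M := fun t => t ^ 3 + W.a₂ * t ^ 2 + W.a₄ * t + W.a₆ -
    (y₀ ^ 2 + W.a₁ * t * y₀ + W.a₃ * y₀)
  have hb0 : b x₀ ≠ 0 := hY
  have he0 : e x₀ = 0 := by
    rw [equation_iff] at h
    simp only [e]
    linear_combination -h
  have id' := hasStrictDerivAt_id x₀
  have hb : ∃ b', HasStrictDerivAt b b' x₀ :=
    ⟨_, ((id'.const_mul W.a₁).const_add (2 * y₀)).add_const W.a₃⟩
  have he : ∃ e', HasStrictDerivAt e e' x₀ :=
    ⟨_, ((((id'.pow 3).add ((id'.pow 2).const_mul W.a₂)).add (id'.const_mul W.a₄)).add_const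
      W.a₆).sub ((((id'.const_mul W.a₁).mul_const y₀).const_add (y₀ ^ 2)).add_const (W.a₃ * y₀))⟩
  obtain ⟨b', hb⟩ := hb
  obtain ⟨e', he⟩ := he
  have hu := he.div (hb.pow 2) (pow_ne_zero 2 hb0)
  have hu0 : (e / b ^ 2) x₀ = 0 := by simp [he0]
  have hφd' : HasStrictDerivAt φ 1⁻¹ ((e / b ^ 2) x₀) := by rwa [hu0]
  have hY' := (hb.mul (hφd'.comp x₀ hu)).const_add y₀
  refine ⟨_, _, hY', by simp [he0, hφ0], ?_⟩
  have h1 : ∀ᶠ t in 𝓝 x₀, φ ((e / b ^ 2) t) ^ 2 + φ ((e / b ^ 2) t) = (e / b ^ 2) t :=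
    hu.hasDerivAt.continuousAt.eventually (hu0.symm ▸ hφi)
  have h2 : ∀ᶠ t in 𝓝 x₀, b t ≠ 0 := hb.hasDerivAt.continuousAt.eventually_ne hb0
  filter_upwards [h1, h2] with t k1 k2
  rw [equation_iff]
  have k3 : b t ^ 2 * (φ ((e / b ^ 2) t) ^ 2 + φ ((e / b ^ 2) t)) = e t := by
    rw [k1]
    simp only [Pi.div_apply, Pi.pow_apply]
    field_simp
  simp only [Pi.mul_apply, Function.comp_apply]
  generalize φ ((e / b ^ 2) t) = s at k3
  simp only [b, e] at k3 ⊢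
  linear_combination k3

/-- The point at infinity is always available as a starting point. In the coordinates `z = -x/y`, `w
= -1/y` the curve is `Φ (z, w) = (z, 0)`, where `Φ` is the identity to first order, so each small
`z` has a `w`. -/
theorem infinite_points [E.IsElliptic] : Infinite (Points E M) := by
  set W := curve E M
  let Φ : M × M → M × M := fun p => (p.1, p.2 - (p.1 * (p.1 ^ 2 + W.a₁ * p.2 + W.a₂ * (p.1 * p.2) +
    W.a₄ * p.2 ^ 2) + p.2 * (W.a₃ * p.2 + W.a₆ * p.2 ^ 2)))
  have hΦ : HasStrictFDerivAt Φ (ContinuousLinearEquiv.refl M (M × M) : M × M →L[M] M × M) 0 := by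
    have h1 : HasStrictFDerivAt (fun p : M × M => p.1) (ContinuousLinearMap.fst M M M) 0 :=
      hasStrictFDerivAt_fst
    have h2 : HasStrictFDerivAt (fun p : M × M => p.2) (ContinuousLinearMap.snd M M M) 0 :=
      hasStrictFDerivAt_snd
    have h3 := h1.prodMk (h2.sub ((h1.mul ((((h1.pow 2).add (h2.const_mul W.a₁)).add
      ((h1.mul h2).const_mul W.a₂)).add ((h2.pow 2).const_mul W.a₄))).add
      (h2.mul ((h2.const_mul W.a₃).add ((h2.pow 2).const_mul W.a₆)))))
    refine h3.congr_fderiv ?_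
    ext <;> simp
  have hmap := hΦ.map_nhds_eq_of_equiv
  have h0 : Φ 0 = 0 := by simp [Φ]
  rw [h0] at hmap
  have hev : ∀ᶠ p in 𝓝 (0 : M × M), ∃ q, Φ q = p := by
    rw [← hmap]
    exact eventually_map.mpr (.of_forall fun q => ⟨q, rfl⟩)
  have hev' : ∀ᶠ z in 𝓝 (0 : M), ∃ q, Φ q = (z, 0) := by
    have : Tendsto (fun z : M => (z, (0 : M))) (𝓝 0) (𝓝 (0 : M × M)) := by
      have : Continuous fun z : M => (z, (0 : M)) := by fun_prop
      exact this.tendsto 0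
    exact this.eventually hev
  have hinf : {z : M | z ≠ 0 ∧ ∃ q, Φ q = (z, 0)}.Infinite := by
    have := infinite_of_mem_nhds (0 : M) hev'
    exact (this.sdiff (Set.finite_singleton 0)).mono fun z hz => ⟨hz.2, hz.1⟩
  have key : ∀ z ∈ {z : M | z ≠ 0 ∧ ∃ q, Φ q = (z, 0)},
      ∃ (P : Points E M) (w : M), HasCoords P (z / w) (-1 / w) ∧ w ≠ 0 := by
    rintro z ⟨hz, ⟨z', w⟩, hq⟩
    obtain ⟨rfl, hw⟩ := Prod.ext_iff.mp hq
    simp only [Φ] at hw hz ⊢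
    have hw0 : w ≠ 0 := by
      rintro rfl
      refine hz ?_
      simpa using hw
    obtain ⟨P, hP⟩ := exists_point_of_equation (E := E) (x := z' / w) (y := -1 / w) (by
      rw [equation_iff]
      field_simp
      linear_combination hw)
    exact ⟨P, w, hP, hw0⟩
  choose! P w hP hw using key
  have := hinf.to_subtype
  refine Infinite.of_injective (fun z : ↥{z : M | z ≠ 0 ∧ ∃ q, Φ q = (z, 0)} => P z) ?_
  intro a b hab
  have h1 := hP a a.2
  have h2 := hP b b.2
  simp only at hab
  rw [hab] at h1
  obtain ⟨e1, e2⟩ := h1.unique h2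
  have ha := hw a a.2
  have hb := hw b b.2
  have e3 : w a = w b := by
    field_simp at e2
    linear_combination e2
  rw [e3] at e1
  field_simp at e1
  exact Subtype.ext e1

/-- A point with nonvanishing `∂/∂Y` is, up to an `n`-fold multiple, a point whose first coordinate
lies in a given dense set. -/
theorem exists_eq_add_nsmul_of_partialY_ne_zero [E.IsElliptic] {s : Set M} (hs : Dense s) {n : ℕ}
    (hn : (n : M) ≠ 0)
    {P : Points E M} {x y : M} (hP : HasCoords P x y) (hY : partialY (curve E M) x y ≠ 0) :
    ∃ (P' R : Points E M) (x' y' : M), P = P' + n • R ∧ HasCoords P' x' y' ∧ x' ∈ s ∧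
      partialY (curve E M) x' y' ≠ 0 := by
  have : Infinite (Points E M) := infinite_points
  obtain ⟨Y, Y', hYd, rfl, hYe⟩ := exists_germ hP.equation hY
  have hT : ∀ t, ∃ T : Points E M, (curve E M).Equation t (Y t) → HasCoords T t (Y t) := fun t => by
    by_cases h : (curve E M).Equation t (Y t)
    · obtain ⟨T, hT⟩ := exists_point_of_equation h
      exact ⟨T, fun _ => hT⟩
    · exact ⟨0, fun h' => absurd h' h⟩
  choose T hT using hT
  have hTx : T x = P := (hT x hYe.self_of_nhds).eq hP
  have hTc : ∀ᶠ t in 𝓝 x, HasCoords (T t) t (Y t) := hYe.mono hT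
  obtain ⟨ω, hω, hTω⟩ : ∃ ω ≠ 0, HasTangent x T ω := by
    refine ⟨1 / partialY (curve E M) x (Y x), by simpa using hY, id, Y, ?_, ?_, hTc⟩
    · convert hasStrictDerivAt_id x using 1
      field_simp
      rfl
    · convert hYd using 1
      have id' := hasStrictDerivAt_id x
      have hzero : (fun t => Y t ^ 2 + (curve E M).a₁ * t * Y t + (curve E M).a₃ * Y t -
          (t ^ 3 + (curve E M).a₂ * t ^ 2 + (curve E M).a₄ * t + (curve E M).a₆)) =ᶠ[𝓝 x] 0 :=
        hYe.mono fun t ht => sub_eq_zero.mpr ((equation_iff _ _).mp ht)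
      have hd := ((((hYd.pow 2).add ((id'.const_mul (curve E M).a₁).mul hYd)).add
        (hYd.const_mul (curve E M).a₃)).sub ((((id'.pow 3).add
        ((id'.pow 2).const_mul (curve E M).a₂)).add (id'.const_mul (curve E M).a₄)).add_const
        (curve E M).a₆)).hasDerivAt
      have h0 := hd.unique ((hasDerivAt_const x (0 : M)).congr_of_eventuallyEq hzero)
      simp only [id] at h0 ⊢
      field_simp
      push_cast at h0
      simp only [partialX, partialY]
      linear_combination -h0
  -- The family `n • T t + B` moves with tangent `n • ω ≠ 0`. Avoiding `∂_Y = 0` makes its first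
  -- coordinate a local homeomorphism; avoiding `0`, `P` and `P + P` makes the chord law applicable
  -- to the next family.
  obtain ⟨B, ⟨Xn, Yn, hXn, hYn, hcn⟩, hav⟩ := exists_chain (Pi.evalAddMonoidHom _ x)
    (Pi.constAddMonoidHom M (Points E M)) (fun a b h => h) (HasTangent x)
    (fun P Q ω ω' h h' hne hne' => h.add h' hne hne') (fun c hc => hasTangent_const x hc) hTω n
    (fun h => hn (by simp [h]))
    ((finite_setOf_partialY_eq_zero (E := E) (K := M)).union (Set.toFinite {0, P, P + P}))
  set An : M → Points E M := n • T + Pi.constAddMonoidHom M (Points E M) B with hAn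
  have hAnt : ∀ t, An t = n • T t + B := fun t => rfl
  replace hav : An x ∉ _ := hav
  simp only [Set.mem_union, Set.mem_insert_iff, Set.mem_singleton_iff, not_or] at hav
  obtain ⟨hav1, hav0, havP, havPP⟩ := hav
  have hYA : partialY (curve E M) (Xn x) (Yn x) ≠ 0 := fun h =>
    hav1 ⟨_, _, hcn.self_of_nhds, h⟩
  -- The translate of `T` by `An x - P` passes through the same point `An x` at `x`. The two
  -- families are to be matched near `x`, giving `n • T σ + B = T t + (An x - P)`.
  obtain ⟨XS, YS, hXS, hYS, hcS⟩ := hTω.add (hasTangent_const x (P := An x - P)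
    (sub_ne_zero.mpr havP)) (by rw [hTx]; exact fun h => havPP (eq_add_of_sub_eq h.symm))
    (by rw [hTx]; exact fun h => hav0 (by simpa using h.symm))
  have hbase : XS x = Xn x ∧ YS x = Yn x := by
    have := hcS.self_of_nhds
    rw [Pi.add_apply, hTx, add_sub_cancel] at this
    exact this.unique hcn.self_of_nhds
  -- Equal first coordinates leave a sign ambiguity. The expression vanishes when the two points are
  -- opposite, while at the base point it equals `∂_Y ≠ 0`.
  have hYne : ∀ᶠ p in 𝓝 x ×ˢ 𝓝 x, Yn p.1 + YS p.2 + (curve E M).a₁ * XS p.2 + (curve E M).a₃ ≠ 0 := by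
    have hcont : Tendsto (fun p : M × M => Yn p.1 + YS p.2 + (curve E M).a₁ * XS p.2 +
        (curve E M).a₃) (𝓝 x ×ˢ 𝓝 x) (𝓝 (Yn x + YS x + (curve E M).a₁ * XS x + (curve E M).a₃)) :=
      (((hYn.hasDerivAt.continuousAt.tendsto.comp tendsto_fst).add (hYS.hasDerivAt.continuousAt.tendsto.comp
        tendsto_snd)).add ((hXS.hasDerivAt.continuousAt.tendsto.comp tendsto_snd).const_mul _)).add_const _
    refine hcont.eventually_ne ?_
    rw [hbase.1, hbase.2, ← two_mul]
    exact hYA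
  obtain ⟨pa, hpa, pb, hpb, hpab⟩ := eventually_prod_iff.mp hYne
  have hmap := hXn.map_nhds_eq (mul_ne_zero (by simpa using ⟨hn, hω⟩) hYA)
  have hex : ∀ᶠ t in 𝓝 x, ∃ s, (pa s ∧ HasCoords (An s) (Xn s) (Yn s)) ∧ Xn s = XS t := by
    have h1 : ∀ᶠ u in 𝓝 (Xn x), ∃ s, (pa s ∧ HasCoords (An s) (Xn s) (Yn s)) ∧ Xn s = u := by
      rw [← hmap]
      exact eventually_map.mpr ((hpa.and hcn).mono fun s hs => ⟨s, hs, rfl⟩)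
    exact hXS.hasDerivAt.continuousAt.eventually (hbase.1.symm ▸ h1)
  have hYt : ∀ᶠ t in 𝓝 x, partialY (curve E M) t (Y t) ≠ 0 := by
    have : Tendsto (fun t => partialY (curve E M) t (Y t)) (𝓝 x)
        (𝓝 (partialY (curve E M) x (Y x))) :=
      ((hYd.hasDerivAt.continuousAt.tendsto.const_mul 2).add (tendsto_id.const_mul _)).add_const _
    exact this.eventually_ne hY
  obtain ⟨t, ⟨⟨σ, ⟨hσa, hσc⟩, hσx⟩, htY, hb, htc, htS⟩, hts⟩ :=
    (mem_closure_iff_frequently.mp (hs x)).and_eventually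
      (hex.and (hYt.and (hpb.and (hTc.and hcS)))) |>.exists.imp fun t h => And.symm h
  have hAS : An σ = T t + (An x - P) := by
    by_contra hne
    rw [hσx] at hσc
    refine hσc.x_ne htS hne (fun h => ?_) rfl
    have := htS.neg.unique (h ▸ hσc)
    refine hpab hσa hb ?_
    rw [← this.2, negY]
    ring
  refine ⟨T t, P - T σ, t, Y t, ?_, htc, hts, htY⟩
  rw [hAnt, hAnt, hTx] at hAS
  have h3 : T t = P - n • P + n • T σ := by
    have h4 : T t = n • T σ + B - (n • P + B - P) := eq_sub_of_add_eq hAS.symm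
    rw [h4]
    abel
  rw [h3, smul_sub]
  abel

/-- Every point is, up to an `n`-fold multiple, a sum of two points whose first coordinates
lie in a given dense set. -/
theorem exists_eq_add_add_nsmul [E.IsElliptic] {s : Set M} (hs : Dense s) {n : ℕ}
    (hn : (n : M) ≠ 0) (P : Points E M) :
    ∃ P₁ P₂ R : Points E M, P = P₁ + P₂ + n • R ∧
      (∃ x y, HasCoords P₁ x y ∧ x ∈ s ∧ partialY (curve E M) x y ≠ 0) ∧
      ∃ x y, HasCoords P₂ x y ∧ x ∈ s ∧ partialY (curve E M) x y ≠ 0 := by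
  have : Infinite (Points E M) := infinite_points
  have hfin := finite_setOf_partialY_eq_zero (E := E) (K := M)
  set Z := {P : Points E M | ∃ x y, HasCoords P x y ∧ partialY (curve E M) x y = 0}
  -- `P` itself may be zero or of order two, so it is split as `P₀ + (P - P₀)` with neither summand
  -- of that kind.
  obtain ⟨P₀, hP₀⟩ := ((hfin.union (Set.toFinite {0, P})).union
    (hfin.preimage (f := fun Q => P - Q) sub_right_injective.injOn)).infinite_compl.nonempty
  simp only [Set.mem_compl_iff, Set.mem_union, Set.mem_insert_iff, Set.mem_singleton_iff,
    Set.mem_preimage, not_or] at hP₀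
  obtain ⟨⟨h1, h0, hPP⟩, h2⟩ := hP₀
  obtain ⟨x₁, y₁, hc₁⟩ := exists_hasCoords h0
  obtain ⟨x₂, y₂, hc₂⟩ := exists_hasCoords (sub_ne_zero.mpr (Ne.symm hPP))
  obtain ⟨P₁, R₁, x₁', y₁', e₁, k₁, m₁, n₁⟩ := exists_eq_add_nsmul_of_partialY_ne_zero hs hn hc₁
    fun h => h1 ⟨_, _, hc₁, h⟩
  obtain ⟨P₂, R₂, x₂', y₂', e₂, k₂, m₂, n₂⟩ := exists_eq_add_nsmul_of_partialY_ne_zero hs hn hc₂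
    fun h => h2 ⟨_, _, hc₂, h⟩
  refine ⟨P₁, P₂, R₁ + R₂, ?_, ⟨_, _, k₁, m₁, n₁⟩, ⟨_, _, k₂, m₂, n₂⟩⟩
  rw [← add_sub_cancel P₀ P, e₂]
  nth_rewrite 1 [e₁]
  rw [smul_add]
  abel

end Germs

/-! ### Places of algebraic extensions of function fields have rank one -/

section RankOne

theorem mem_of_isIntegral_int {T : Type*} [Field T] (O : ValuationSubring T) {x : T}
    (hx : IsIntegral ℤ x) : x ∈ O := by
  have h : IsIntegral O x := hx.tower_top
  obtain ⟨y, rfl⟩ := IsIntegrallyClosed.isIntegral_iff.mp h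
  exact y.2

variable {k T : Type*} [Field k] [Field T] [Algebra k T]

theorem algebraMap_mem_valuationSubring (hk : ∀ x : k, IsIntegral ℤ x) (O : ValuationSubring T)
    (x : k) : algebraMap k T x ∈ O :=
  mem_of_isIntegral_int O ((hk x).map (algebraMap k T).toIntAlgHom)

theorem aeval_mem_valuationSubring (hk : ∀ x : k, IsIntegral ℤ x) (O : ValuationSubring T) {a : T}
    (ha : a ∈ O) (q : Polynomial k) : Polynomial.aeval a q ∈ O := by
  rw [Polynomial.aeval_eq_sum_range]
  refine sum_mem fun i _ => ?_
  rw [Algebra.smul_def]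
  exact mul_mem (algebraMap_mem_valuationSubring hk O _) (pow_mem ha i)

/-- Constants have valuation at most one, nonzero constants exactly one, so the lowest term of `q`
dominates at `a`. -/
theorem exists_valuation_aeval_eq (hk : ∀ x : k, IsIntegral ℤ x) (O : ValuationSubring T) {a : T}
    (ha : O.valuation a < 1) {q : Polynomial k} (hq : q ≠ 0) :
    ∃ m : ℕ, O.valuation (Polynomial.aeval a q) = O.valuation a ^ m := by
  obtain ⟨q', hq', h0⟩ := Polynomial.exists_eq_pow_rootMultiplicity_mul_and_not_dvd q hq 0
  rw [Polynomial.C_0, sub_zero] at hq' h0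
  refine ⟨Polynomial.rootMultiplicity 0 q, ?_⟩
  rw [hq', map_mul, map_pow, Polynomial.aeval_X, map_mul, map_pow]
  have haO : a ∈ O := (O.valuation_le_one_iff a).mp ha.le
  have hc : q'.coeff 0 ≠ 0 := fun h => h0 (Polynomial.X_dvd_iff.mpr h)
  have h1 : O.valuation (algebraMap k T (q'.coeff 0)) = 1 := by
    refine le_antisymm ((O.valuation_le_one_iff _).mpr (algebraMap_mem_valuationSubring hk O _)) ?_
    have h2 := (O.valuation_le_one_iff _).mpr
      (algebraMap_mem_valuationSubring hk O (q'.coeff 0)⁻¹)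
    rw [map_inv₀, map_inv₀] at h2
    rwa [inv_le_one₀] at h2
    rw [zero_lt_iff, (O.valuation).ne_zero_iff]
    exact (map_ne_zero _).mpr hc
  have h3 : O.valuation (Polynomial.aeval a q'.divX * a) < 1 := by
    rw [map_mul]
    refine lt_of_le_of_lt (mul_le_of_le_one_left' ?_) ha
    exact (O.valuation_le_one_iff _).mpr (aeval_mem_valuationSubring hk O haO _)
  have h4 : Polynomial.aeval a q' = Polynomial.aeval a q'.divX * a
      + algebraMap k T (q'.coeff 0) := by
    conv_lhs => rw [← Polynomial.divX_mul_X_add q']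
    simp
  rw [h4, Valuation.map_add_eq_of_lt_right _ (by rwa [h1]), h1, mul_one, ← hq']

/-- For `y = v(b) > 1` the element `b⁻¹` is transcendental, so `c` is algebraic over `k[b⁻¹]`, a
subring of `O`. Some nonzero `z` in it makes `z c` integral, hence `v(z c) ≤ 1`, and `v(z)` is a
power of `v(b)⁻¹`. -/
theorem mulArchimedean_valueGroup (hk : ∀ x : k, IsIntegral ℤ x)
    (hT : ∀ a : T, Transcendental k a → Algebra.IsAlgebraic (Algebra.adjoin k {a}) T)
    (O : ValuationSubring T) : MulArchimedean O.ValueGroup := by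
  refine ⟨fun x y hy => ?_⟩
  obtain ⟨b, rfl⟩ := O.valuation_surjective y
  obtain ⟨c, rfl⟩ := O.valuation_surjective x
  have hb0 : b ≠ 0 := by
    rintro rfl
    simp at hy
  have ha : O.valuation b⁻¹ < 1 := by
    rw [map_inv₀]
    exact inv_lt_one_of_one_lt₀ hy
  have htr : Transcendental k b⁻¹ := by
    intro h
    refine (not_lt.mpr ((O.valuation_le_one_iff b).mpr (mem_of_isIntegral_int O ?_))) hy
    have h5 : IsIntegral k b := by
      rw [← inv_inv b]
      exact h.isIntegral.inv
    have : Algebra.IsIntegral ℤ k := ⟨hk⟩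
    exact isIntegral_trans b h5
  have := hT _ htr
  have hle : ∀ z : Algebra.adjoin k {b⁻¹}, (z : T) ∈ O := by
    intro z
    obtain ⟨q, hq⟩ := (Algebra.adjoin_singleton_eq_range_aeval k b⁻¹).le z.2
    rw [← show Polynomial.aeval b⁻¹ q = (z : T) from hq]
    exact aeval_mem_valuationSubring hk O ((O.valuation_le_one_iff _).mp ha.le) q
  obtain ⟨z, hz0, hz⟩ := (Algebra.IsAlgebraic.isAlgebraic (R := Algebra.adjoin k {b⁻¹})
    c).exists_integral_multiple
  have hzc : (z : T) * c ∈ O := by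
    have hz' : IsIntegral (Algebra.adjoin k {b⁻¹}) ((z : T) * c) := hz
    let i : Algebra.adjoin k {b⁻¹} →+* O :=
      (algebraMap (Algebra.adjoin k {b⁻¹}) T).codRestrict O.toSubring hle
    obtain ⟨P, hP, hP0⟩ := hz'
    have : IsIntegral O ((z : T) * c) := ⟨P.map i, hP.map i, by
      rw [Polynomial.eval₂_map]
      exact hP0⟩
    obtain ⟨y, hy⟩ := IsIntegrallyClosed.isIntegral_iff.mp this
    exact hy ▸ y.2
  obtain ⟨q, hq⟩ := (Algebra.adjoin_singleton_eq_range_aeval k b⁻¹).le z.2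
  have hq' : Polynomial.aeval b⁻¹ q = (z : T) := hq
  obtain ⟨m, hm⟩ := exists_valuation_aeval_eq hk O ha (q := q) (by
    rintro rfl
    rw [map_zero] at hq'
    exact hz0 (Subtype.ext hq'.symm))
  refine ⟨m, ?_⟩
  have h6 := (O.valuation_le_one_iff _).mpr hzc
  rw [map_mul, ← hq', hm, map_inv₀, inv_pow, mul_comm, ← div_eq_mul_inv] at h6
  rwa [div_le_one₀] at h6
  exact pow_pos (zero_lt_one.trans hy) m

/-- `T` has transcendence degree at most one over `k`, so a single transcendental element is a
transcendence basis. -/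
theorem isAlgebraic_adjoin_of_transcendental {F T : Type*} [Field F] [Field T] [Algebra k F]
    [Algebra (RatFunc k) F] [IsScalarTower k (RatFunc k) F] [FunctionField k F]
    [Algebra k T] [Algebra F T] [IsScalarTower k F T] [Algebra.IsAlgebraic F T] (a : T)
    (ha : Transcendental k a) : Algebra.IsAlgebraic (Algebra.adjoin k {a}) T := by
  let i : RatFunc k →+* T := (algebraMap F T).comp (algebraMap (RatFunc k) F)
  let t : T := i RatFunc.X
  let _ : Algebra (RatFunc k) T := i.toAlgebra
  have : IsScalarTower (RatFunc k) F T := IsScalarTower.of_algebraMap_eq fun _ => rfl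
  have h1 : Algebra.IsAlgebraic (RatFunc k) T := Algebra.IsAlgebraic.trans (RatFunc k) F T
  let _ : Algebra (Polynomial k) T := (i.comp (algebraMap (Polynomial k) (RatFunc k))).toAlgebra
  have : IsScalarTower (Polynomial k) (RatFunc k) T := IsScalarTower.of_algebraMap_eq fun _ => rfl
  have h2 : Algebra.IsAlgebraic (Polynomial k) T :=
    (IsFractionRing.comap_isAlgebraic_iff (A := Polynomial k) (K := RatFunc k) (C := T)).mpr h1
  have h3 : ∀ q : Polynomial k, algebraMap (Polynomial k) T q = Polynomial.aeval t q := by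
    intro q
    change i (algebraMap _ _ q) = _
    induction q using Polynomial.induction_on' with
    | add p q hp hq => simp only [map_add, hp, hq]
    | monomial n c =>
      rw [Polynomial.aeval_monomial, ← Polynomial.C_mul_X_pow_eq_monomial, map_mul, map_mul,
        map_pow, map_pow, RatFunc.algebraMap_X, RatFunc.algebraMap_C, ← RatFunc.algebraMap_eq_C]
      change algebraMap F T (algebraMap (RatFunc k) F (algebraMap k (RatFunc k) c)) * _ = _
      rw [← IsScalarTower.algebraMap_apply k (RatFunc k) F, ← IsScalarTower.algebraMap_apply k F T]
  have h4 : Algebra.IsAlgebraic (Algebra.adjoin k {t}) T := by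
    let _ : Algebra (Polynomial k) (Algebra.adjoin k {t}) :=
      ((algebraMap (Polynomial k) T).codRestrict (Algebra.adjoin k {t}) fun q => by
        rw [h3]
        exact (Algebra.adjoin_singleton_eq_range_aeval k t).ge ⟨q, rfl⟩).toAlgebra
    have : IsScalarTower (Polynomial k) (Algebra.adjoin k {t}) T :=
      IsScalarTower.of_algebraMap_eq fun _ => rfl
    have hinj : Function.Injective (algebraMap (Polynomial k) (Algebra.adjoin k {t})) := by
      refine Function.Injective.of_comp (f := Subtype.val) ?_
      exact i.injective.comp (IsFractionRing.injective (Polynomial k) (RatFunc k))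
    exact Algebra.IsAlgebraic.extendScalars hinj
  have h5 : Algebra.trdeg k T ≤ 1 := by
    simpa using Algebra.IsAlgebraic.trdeg_le_cardinalMk (R := k) (s := {t}) (A := T)
  have h6 := AlgebraicIndependent.isTranscendenceBasis_of_trdeg_le_of_finite
    (ι := PUnit) (x := fun _ => a) (R := k)
    (algebraicIndependent_unique_type_iff.mpr ha) (by simpa using h5)
  have h7 := h6.isAlgebraic
  rwa [Set.range_const] at h7

end RankOne

/-! ### Completions as normed fields -/

section Normed

open Valuation

theorem valued_coe {T : Type*} [Field T] (O : ValuationSubring T) (x : T) :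
    Valued.v (WithVal.toVal O.valuation x : O.valuation.Completion) = O.valuation x :=
  Valued.valuedCompletion_apply (K := WithVal O.valuation) _

theorem nonempty_rankOne_completion {T : Type*} [Field T] (O : ValuationSubring T) (hO : O ≠ ⊤)
    [MulArchimedean O.ValueGroup] :
    Nonempty (Valued.v : Valuation O.valuation.Completion O.ValueGroup).RankOne := by
  have : MulArchimedean (MonoidWithZeroHom.ValueGroup₀ (.ofClass
      (Valued.v : Valuation O.valuation.Completion O.ValueGroup))) :=
    MulArchimedean.comap MonoidWithZeroHom.ValueGroup₀.embedding.toMonoidHom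
      MonoidWithZeroHom.ValueGroup₀.embedding_strictMono
  have h : (Valued.v : Valuation O.valuation.Completion O.ValueGroup).IsNontrivial := by
    obtain ⟨x, hx⟩ : ∃ x, x ∉ O := by
      by_contra! h
      exact hO (eq_top_iff.mpr fun x _ => h x)
    refine ⟨⟨(WithVal.toVal O.valuation x : O.valuation.Completion), ?_, ?_⟩⟩
    · rw [valued_coe, ne_eq, map_eq_zero]
      rintro rfl
      exact hx (zero_mem _)
    · rw [valued_coe]
      intro h
      exact hx ((O.valuation_le_one_iff x).mp h.le)
  exact nonempty_rankOne_iff_mulArchimedean.mpr this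

/-- The norm is provided existentially, together with the equality of field structures, so that it
can be identified with the given field later on. -/
theorem Place.exists_normedField {T : Type*} [Field T] (w : Place T)
    [MulArchimedean w.1.ValueGroup] :
    ∃ N : NontriviallyNormedField w.Completion,
      N.toNormedField.toField = (inferInstance : Field w.Completion) ∧
      CompleteSpace w.Completion ∧ IsUltrametricDist w.Completion ∧ DenseRange w.embedding ∧
      ∀ x, ‖w.embedding x‖ < 1 ↔ w.1.valuation x < 1 := by
  obtain ⟨hr⟩ := nonempty_rankOne_completion w.1 w.2
  refine ⟨Valued.toNontriviallyNormedField w.1.valuation.Completion w.1.ValueGroup, rfl, ?_, ?_,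
    ?_, ?_⟩
  · exact inferInstanceAs (CompleteSpace (UniformSpace.Completion (WithVal w.1.valuation)))
  · exact Valued.instIsUltrametricDist w.1.valuation.Completion w.1.ValueGroup
  · exact UniformSpace.Completion.denseRange_coe.comp (f := WithVal.toVal w.1.valuation)
      (WithVal.equiv w.1.valuation).symm.surjective.denseRange
      (UniformSpace.Completion.continuous_coe _)
  · intro x
    rw [← valued_coe w.1 x]
    exact Valued.toNormedField.norm_lt_one_iff (L := w.1.valuation.Completion)
      (Γ₀ := w.1.ValueGroup) (x := (WithVal.toVal w.1.valuation x : w.1.valuation.Completion))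

/-- Absolute values with the same open unit ball are powers of each other. So `j` is uniformly
continuous for the topology induced by `i`, and its extension raises norms to a fixed power `s > 0`.
-/
theorem exists_ringHom_extension {L K M : Type*} [Field L] [NormedField K] [NormedField M]
    [CompleteSpace M] (i : L →+* K) (j : L →+* M) (hi : DenseRange i)
    (h : ∀ x, ‖i x‖ < 1 ↔ ‖j x‖ < 1) :
    ∃ f : K →+* M, (∀ x, f (i x) = j x) ∧ IsUniformInducing f := by
  let a : AbsoluteValue L ℝ := (NormedField.toAbsoluteValue K).comp i.injective
  let b : AbsoluteValue L ℝ := (NormedField.toAbsoluteValue M).comp j.injective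
  obtain ⟨s, hs, hab⟩ := AbsoluteValue.isEquiv_iff_exists_rpow_eq.mp
    (AbsoluteValue.isEquiv_iff_lt_one_iff.mpr h : a.IsEquiv b)
  have hij : ∀ x, ‖j x‖ = ‖i x‖ ^ s := fun x => (congrFun hab x).symm
  let _ : NormedField L := NormedField.induced L K i i.injective
  have hiso : IsUniformInducing i := ⟨rfl⟩
  have hcont : UniformContinuous j := by
    refine uniformContinuous_of_continuousAt_zero j ?_
    rw [ContinuousAt, map_zero, tendsto_zero_iff_norm_tendsto_zero]
    simp only [hij]
    have h1 : Filter.Tendsto (fun x : L => ‖i x‖) (nhds 0) (nhds 0) := by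
      have := (hiso.uniformContinuous.continuous.norm).tendsto (0 : L)
      rwa [map_zero, norm_zero] at this
    have h2 := (Real.continuousAt_rpow_const 0 s (Or.inr hs.le)).tendsto.comp h1
    rwa [Real.zero_rpow hs.ne'] at h2
  let f := IsDenseInducing.extendRingHom hiso hi hcont
  have hf : ∀ x, f (i x) = j x := fun x =>
    (hiso.isDenseInducing hi).extend_eq hcont.continuous x
  have hfc : Continuous f := (uniformContinuous_uniformly_extend hiso hi hcont).continuous
  refine ⟨f, hf, ?_⟩
  have hnorm : ∀ x, ‖f x‖ = ‖x‖ ^ s := by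
    refine fun x => hi.induction_on (p := fun x => ‖f x‖ = ‖x‖ ^ s) x ?_ fun x => ?_
    · exact isClosed_eq hfc.norm (continuous_norm.rpow_const fun x => Or.inr hs.le)
    · rw [hf, hij]
  refine Metric.isUniformInducing_iff.mpr
    ⟨uniformContinuous_uniformly_extend hiso hi hcont, fun δ hδ => ⟨δ ^ s, by positivity, ?_⟩⟩
  intro x y hxy
  rw [dist_eq_norm, ← _root_.map_sub, hnorm] at hxy
  rw [dist_eq_norm]
  exact (Real.rpow_lt_rpow_iff (norm_nonneg _) hδ.le hs).mp hxy

/-- With the norm induced by `f`, the field `K` is complete, so its norm extends uniquely to `Ω`.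
The pullback of the spectral norm of `Ω'` is therefore the spectral norm of `Ω`, which is Galois
invariant. -/
theorem spectralNorm_galois_invariant {K M Ω Ω' : Type*} [Field K] [NontriviallyNormedField M]
    [CompleteSpace M] [IsUltrametricDist M] [Field Ω] [Field Ω'] [Algebra K Ω] [Algebra M Ω']
    [Algebra.IsAlgebraic K Ω] [Algebra.IsAlgebraic M Ω'] (f : K →+* M)
    (hf : IsComplete (Set.range f)) (hf' : ∃ x, 1 < ‖f x‖) (ι : Ω →+* Ω')
    (hι : ∀ x, ι (algebraMap K Ω x) = algebraMap M Ω' (f x)) (τ : Gal(Ω/K)) (y : Ω) :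
    spectralNorm M Ω' (ι (τ y)) = spectralNorm M Ω' (ι y) := by
  let _ : NontriviallyNormedField K :=
    { NormedField.induced K M f f.injective with non_trivial := hf' }
  have hu : IsUniformInducing f := ⟨rfl⟩
  have : CompleteSpace K := (completeSpace_iff_isComplete_range hu).mpr hf
  have : IsUltrametricDist K := ⟨fun x y z => by
    change dist (f x) (f z) ≤ max (dist (f x) (f y)) (dist (f y) (f z))
    exact dist_triangle_max _ _ _⟩
  let a : AbsoluteValue Ω ℝ :=
    { toFun := fun y => spectralNorm M Ω' (ι y)
      map_mul' := fun x y => by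
        rw [map_mul]
        exact map_mul (spectralMulAlgNorm M Ω') _ _
      nonneg' := fun x => spectralNorm_nonneg _
      eq_zero' := fun x => by
        refine ⟨fun h => ?_, fun h => by rw [h, map_zero, spectralNorm_zero]⟩
        rw [← map_eq_zero ι]
        exact eq_zero_of_map_spectralNorm_eq_zero h (Algebra.IsAlgebraic.isAlgebraic _)
      add_le' := fun x y => by
        rw [map_add]
        exact (isNonarchimedean_spectralNorm _ _).trans
          (max_le_add_of_nonneg (spectralNorm_nonneg _) (spectralNorm_nonneg _)) }
  have ha : ∀ z, a z = spectralNorm K Ω z := spectralNorm_unique_field_norm_ext (f := a) fun x => by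
    change spectralNorm M Ω' (ι _) = _
    rw [hι, spectralNorm_extends]
    rfl
  change a (τ y) = a y
  rw [ha, ha]
  exact (spectralNorm_eq_of_equiv τ y).symm

end Normed

/-! ### Extending places -/

section ExtendPlaces

variable {L T : Type*} [Field L] [Field T] [Algebra L T]

theorem valuation_lt_one_iff_inv_notMem (O : ValuationSubring L) (x : L) :
    O.valuation x < 1 ↔ x = 0 ∨ x⁻¹ ∉ O := by
  rcases eq_or_ne x 0 with rfl | hx
  · simp
  rw [← O.valuation_le_one_iff, map_inv₀, inv_le_one₀ (by
    rw [zero_lt_iff, (O.valuation).ne_zero_iff]; exact hx)]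
  simp [hx]

theorem valuation_comap_lt_one_iff (O : ValuationSubring T) (x : L) :
    (O.comap (algebraMap L T)).valuation x < 1 ↔ O.valuation (algebraMap L T x) < 1 := by
  rw [valuation_lt_one_iff_inv_notMem, valuation_lt_one_iff_inv_notMem,
    ValuationSubring.mem_comap, map_inv₀, map_eq_zero]

theorem comap_ne_top [Algebra.IsAlgebraic L T] {O : ValuationSubring T} (hO : O ≠ ⊤) :
    O.comap (algebraMap L T) ≠ ⊤ := by
  refine fun h => hO (eq_top_iff.mpr fun x _ => ?_)
  have hL : ∀ y : L, algebraMap L T y ∈ O := fun y =>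
    ValuationSubring.mem_comap.mp (h ▸ ValuationSubring.mem_top y)
  obtain ⟨P, hP, hP0⟩ := Algebra.IsIntegral.isIntegral (R := L) x
  let i : L →+* O := (algebraMap L T).codRestrict O.toSubring hL
  have : IsIntegral O x := ⟨P.map i, hP.map i, by
    rw [Polynomial.eval₂_map]
    exact hP0⟩
  obtain ⟨y, hy⟩ := IsIntegrallyClosed.isIntegral_iff.mp this
  exact hy ▸ y.2

/-- A valuation ring of `T` dominating `O` contracts to `O`: an `x` outside `O` but inside it would
turn the nonunit `x⁻¹` of `O` into a unit. -/
theorem exists_comap_eq (O : ValuationSubring L) :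
    ∃ O' : ValuationSubring T, O'.comap (algebraMap L T) = O := by
  obtain ⟨O', h⟩ := (O.toLocalSubring.map (algebraMap L T)).exists_le_valuationSubring
  obtain ⟨h1, h2⟩ := h
  have h3 : ∀ x : O, algebraMap L T x ∈ O' := fun x => h1 ⟨x, x.2, rfl⟩
  refine ⟨O', le_antisymm (fun x hx => ?_) fun x hx => h3 ⟨x, hx⟩⟩
  by_contra hxO
  have hx0 : x ≠ 0 := fun h => hxO (h ▸ zero_mem _)
  have hy : x⁻¹ ∈ O := (O.mem_or_inv_mem x).resolve_left hxO
  let y : (O.toLocalSubring.map (algebraMap L T)).toSubring :=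
    ⟨algebraMap L T x⁻¹, ⟨x⁻¹, hy, rfl⟩⟩
  have hy' : IsUnit (Subring.inclusion h1 y) := by
    refine IsUnit.of_mul_eq_one ⟨algebraMap L T x, hx⟩ (Subtype.ext ?_)
    change algebraMap L T x⁻¹ * algebraMap L T x = 1
    rw [← map_mul, inv_mul_cancel₀ hx0, map_one]
  obtain ⟨⟨-, z, hz, rfl⟩, hz'⟩ := (h2.map_nonunit y hy').exists_right_inv
  have hz'' : algebraMap L T x⁻¹ * algebraMap L T z = 1 := congrArg Subtype.val hz'
  rw [← map_mul, map_eq_one_iff _ (algebraMap L T).injective] at hz''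
  have hzx : z = x := by
    field_simp at hz''
    exact hz''
  exact hxO (hzx ▸ hz)

end ExtendPlaces

/-! ### Descent of local points to the separable closure of the global field -/

section Descent

open WeierstrassCurve.Affine Polynomial

/-- Since `2y + b ≠ 0` the discriminant is nonzero, so the quadratic is separable and has a root
`y₀` in `S`; the other root is `-y₀ - b`. -/
theorem exists_eq_of_quadratic {S Ω : Type*} [Field S] [Field Ω] [IsSepClosed S] (j : S →+* Ω)
    (b c : S) {y : Ω} (hy : y ^ 2 + j b * y + j c = 0) (hd : 2 * y + j b ≠ 0) :
    ∃ y₀, j y₀ = y := by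
  have hdisc : b ^ 2 - 4 * c ≠ 0 := by
    intro h
    have h' : (2 * y + j b) ^ 2 = 0 := by
      have h1 := congrArg j h
      simp only [map_sub, map_pow, map_mul, map_ofNat, map_zero] at h1
      linear_combination 4 * hy + h1
    exact hd (pow_eq_zero_iff two_ne_zero |>.mp h')
  let p : S[X] := X ^ 2 + C b * X + C c
  have hdeg : p.degree = 2 := by
    simp only [p]
    compute_degree!
  have hsep : p.Separable := by
    refine ⟨-C (4 / (b ^ 2 - 4 * c)), C (1 / (b ^ 2 - 4 * c)) * (2 * X + C b), ?_⟩
    have hder : derivative p = 2 * X + C b := by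
      simp only [p, derivative_add, derivative_X_sq, derivative_C_mul, derivative_X, derivative_C,
        map_ofNat, mul_one, add_zero]
    have h1 : C (b ^ 2 - 4 * c) * C (1 / (b ^ 2 - 4 * c)) = 1 := by
      rw [← C_mul, mul_one_div_cancel hdisc, C_1]
    have h2 : C (4 / (b ^ 2 - 4 * c)) = 4 * C (1 / (b ^ 2 - 4 * c)) := by
      rw [← map_ofNat C, ← C_mul, mul_one_div]
    rw [hder, h2]
    simp only [map_sub, map_pow, map_mul, map_ofNat] at h1
    simp only [p]
    linear_combination h1
  obtain ⟨y₀, hy₀⟩ := IsSepClosed.exists_root p (by rw [hdeg]; decide) hsep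
  have hy₁ : y₀ ^ 2 + b * y₀ + c = 0 := by
    simpa [p] using hy₀
  have hy₂ := congrArg j hy₁
  simp only [map_add, map_pow, map_mul, map_zero] at hy₂
  have h : (y - j y₀) * (y + j y₀ + j b) = 0 := by
    linear_combination hy - hy₂
  rcases mul_eq_zero.mp h with h | h
  · exact ⟨y₀, (sub_eq_zero.mp h).symm⟩
  · refine ⟨-y₀ - b, ?_⟩
    rw [map_sub, map_neg]
    linear_combination -h

variable {F : Type*} [Field F] {E : WeierstrassCurve F} {S M Ω : Type*} [Field S] [Field Ω]
  [Algebra F S] [Algebra F Ω] [IsSepClosed S]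

theorem exists_map_eq_map_of_partialY_ne_zero [Field M] [Algebra F M] [Algebra M Ω]
    [IsScalarTower F M Ω] (j : S →ₐ[F] Ω) {P : Points E M} {x y : M} (h : HasCoords P x y)
    {x₀ : S} (hx : j x₀ = algebraMap M Ω x) (hy : partialY (curve E M) x y ≠ 0) :
    ∃ P₀, Points.map E j P₀ = Points.map E (IsScalarTower.toAlgHom F M Ω) P := by
  have ha : ∀ a : F, algebraMap M Ω (algebraMap F M a) = algebraMap F Ω a := fun a =>
    (IsScalarTower.algebraMap_apply F M Ω a).symm
  have he : y ^ 2 + algebraMap F M E.a₁ * x * y + algebraMap F M E.a₃ * y = x ^ 3 +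
      algebraMap F M E.a₂ * x ^ 2 + algebraMap F M E.a₄ * x + algebraMap F M E.a₆ :=
    (equation_iff _ _).mp h.equation
  replace he := congrArg (algebraMap M Ω) he
  simp only [map_add, map_mul, map_pow, ha] at he
  obtain ⟨y₀, hy₀⟩ := exists_eq_of_quadratic (j : S →+* Ω)
    (algebraMap F S E.a₁ * x₀ + algebraMap F S E.a₃)
    (-(x₀ ^ 3 + algebraMap F S E.a₂ * x₀ ^ 2 + algebraMap F S E.a₄ * x₀ + algebraMap F S E.a₆))
    (y := algebraMap M Ω y) (by
      simp only [map_add, map_neg, map_mul, map_pow, RingHom.coe_coe, AlgHom.commutes, hx]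
      linear_combination he) (by
      intro h0
      apply hy
      change 2 * y + algebraMap F M E.a₁ * x + algebraMap F M E.a₃ = 0
      apply (algebraMap M Ω).injective
      simp only [map_add, map_mul, RingHom.coe_coe, AlgHom.commutes, hx] at h0
      simp only [map_add, map_mul, map_zero, map_ofNat, ha]
      linear_combination h0)
  refine exists_map_eq_of_hasCoords j (x := x₀) (y := y₀) ?_
  rw [hx, show j y₀ = _ from hy₀]
  exact h.map (IsScalarTower.toAlgHom F M Ω)

/-- Write `P = P₁ + P₂ + n • R` with `P₁`, `P₂` defined over `S`. Then `Q - R` is an `n`-division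
point of an `S`-point, hence an `S`-point. -/
theorem exists_eq_map_add_map [NontriviallyNormedField M] [CompleteSpace M] [Algebra F M]
    [Algebra M Ω] [IsScalarTower F M Ω] [Infinite S] [E.IsElliptic] (j : S →ₐ[F] Ω)
    (hd : Dense {m : M | ∃ x : S, j x = algebraMap M Ω m}) {n : ℕ} (hn : (n : M) ≠ 0)
    {Q : Points E Ω} {P : Points E M}
    (h : n • Q = Points.map E (IsScalarTower.toAlgHom F M Ω) P) :
    ∃ (Q₀ : Points E S) (R : Points E M),
      Q = Points.map E j Q₀ + Points.map E (IsScalarTower.toAlgHom F M Ω) R := by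
  obtain ⟨P₁, P₂, R, rfl, ⟨x₁, y₁, h₁, ⟨z₁, hz₁⟩, hy₁⟩, ⟨x₂, y₂, h₂, ⟨z₂, hz₂⟩, hy₂⟩⟩ :=
    exists_eq_add_add_nsmul hd hn P
  obtain ⟨A₁, hA₁⟩ := exists_map_eq_map_of_partialY_ne_zero j h₁ hz₁ hy₁
  obtain ⟨A₂, hA₂⟩ := exists_map_eq_map_of_partialY_ne_zero j h₂ hz₂ hy₂
  have hnΩ : (n : Ω) ≠ 0 := by
    rw [← map_natCast (algebraMap M Ω)]
    exact (_root_.map_ne_zero _).mpr hn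
  obtain ⟨Q₀, hQ₀⟩ := exists_map_eq_of_nsmul (E := E) j hnΩ
    (Q := Q - Points.map E (IsScalarTower.toAlgHom F M Ω) R) (P := A₁ + A₂) (by
      rw [smul_sub, h, map_add, map_add, map_add, map_nsmul, hA₁, hA₂]
      abel)
  exact ⟨Q₀, R, by rw [hQ₀, sub_add_cancel]⟩

end Descent

/-! ### Galois groups and embeddings -/

section Embeddings

variable {F S : Type*} [Field F] [Field S] [Algebra F S]

theorem exists_algEquiv_comp_eq [Normal F S] {C : Type*} [Field C] [Algebra F C]
    (j j' : S →ₐ[F] C) : ∃ g : Gal(S/F), ∀ x, j x = j' (g x) := by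
  let _ : Algebra S C := j'.toRingHom.toAlgebra
  have _ : IsScalarTower F S C := IsScalarTower.of_algebraMap_eq fun x => (j'.commutes x).symm
  exact ⟨j.restrictNormal' S, fun x => (j.restrictNormal_commutes S x).symm⟩

theorem exists_algEquiv_restrict {K M Ω Ω' : Type*} [Field K] [Field M] [Field Ω] [Field Ω']
    [Algebra K Ω] [Algebra M Ω'] [Normal K Ω] (f : K →+* M) (ι : Ω →+* Ω')
    (hι : ∀ x, ι (algebraMap K Ω x) = algebraMap M Ω' (f x)) (τ : Gal(Ω'/M)) :
    ∃ τ' : Gal(Ω/K), ∀ x, ι (τ' x) = τ (ι x) := by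
  let _ : Algebra K Ω' := ((algebraMap M Ω').comp f).toAlgebra
  let ι' : Ω →ₐ[K] Ω' := { ι with commutes' := hι }
  have hτ : ∀ x, τ (ι (algebraMap K Ω x)) = algebraMap M Ω' (f x) := fun x =>
    (congrArg τ (hι x)).trans (τ.commutes _)
  let ι'' : Ω →ₐ[K] Ω' := { τ.toRingEquiv.toRingHom.comp ι with commutes' := hτ }
  obtain ⟨g, hg⟩ := exists_algEquiv_comp_eq ι'' ι'
  exact ⟨g, fun x => (hg x).symm⟩

theorem exists_lift_sepClosure {K M : Type*} [Field K] [Field M] [Algebra F K] [Algebra F M]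
    (f : K →ₐ[F] M) : ∃ ι : SepClosure K →ₐ[F] SepClosure M,
      ∀ x, ι (algebraMap K _ x) = algebraMap M _ (f x) := by
  let _ : Algebra K (SepClosure M) := ((algebraMap M (SepClosure M)).comp f).toAlgebra
  have _ : IsScalarTower F K (SepClosure M) := IsScalarTower.of_algebraMap_eq fun x => by
    change _ = algebraMap M (SepClosure M) (f (algebraMap F K x))
    rw [f.commutes, ← IsScalarTower.algebraMap_apply]
  exact ⟨sepLift F (SepClosure K) (SepClosure M) K, sepLift_algebraMap (C := SepClosure M) K⟩

/-- The restrictions of `Gal(Ω/M)` form a compact, hence closed, subgroup. By the Galois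
correspondence it contains everything that fixes its fixed field, and that field is what `j` sends
into `M`. -/
theorem exists_algEquiv_of_fixes [IsGalois F S] {M Ω : Type*} [Field M] [Field Ω] [Algebra F M]
    [Algebra F Ω] [Algebra M Ω] [IsScalarTower F M Ω] [IsGalois M Ω] (j : S →ₐ[F] Ω)
    (σ : Gal(S/F)) (hσ : ∀ x, j x ∈ Set.range (algebraMap M Ω) → σ x = x) :
    ∃ τ : Gal(Ω/M), ∀ x, j (σ x) = τ (j x) := by
  have hcont : Continuous (restrictGal (K := M) j) := continuous_restrictGal j
  let H : Subgroup Gal(S/F) := (restrictGal (K := M) j).range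
  have hH : IsClosed (H : Set Gal(S/F)) := by
    have := (isCompact_range hcont).isClosed
    rwa [← MonoidHom.coe_range] at this
  have hmem : σ ∈ (IntermediateField.fixedField H).fixingSubgroup := by
    rw [IntermediateField.mem_fixingSubgroup_iff]
    intro x hx
    refine hσ x ((InfiniteGalois.mem_range_algebraMap_iff_fixed (j x)).mpr fun τ => ?_)
    rw [← restrictGal_commutes j τ x]
    exact congrArg j (hx ⟨_, τ, rfl⟩)
  rw [InfiniteGalois.fixingSubgroup_fixedField ⟨H, hH⟩] at hmem
  obtain ⟨τ, rfl⟩ := hmem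
  exact ⟨τ, restrictGal_commutes j τ⟩

end Embeddings

/-! ### Comparison of local conditions -/

section LocalConditions

open Topology

variable {F : Type*} [Field F] {E : WeierstrassCurve F} {r : ℕ}

theorem Points.map_smul {S K K' Ω : Type*} [Field S] [Field K] [Field K'] [Field Ω] [Algebra F S]
    [Algebra F K] [Algebra K S] [IsScalarTower F K S] [Algebra F Ω] [Algebra F K'] [Algebra K' Ω]
    [IsScalarTower F K' Ω] (j : S →ₐ[F] Ω) {σ : Gal(S/K)} {τ : Gal(Ω/K')}
    (h : ∀ x, j (σ x) = τ (j x)) (P : Points E S) :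
    Points.map E j (σ • P) = τ • Points.map E j P := by
  change Points.map E _ (Points.map E _ P) = Points.map E _ (Points.map E _ P)
  rw [Points.map_map, Points.map_map]
  congr 2
  exact AlgHom.ext h

variable {L L' : IntermediateField F (SepClosure F)}

/-- The localisation of the cocycle `c` along the embedding `j` is a coboundary in `E(Ω)`. -/
def LocallyTrivial (c : Z1 L.fixingSubgroup (torsion E r (SepClosure F))) (K : Type*) [Field K]
    [Algebra F K] {Ω : Type*} [Field Ω] [Algebra F Ω] [Algebra K Ω] [IsScalarTower F K Ω]
    (j : SepClosure F →ₐ[F] Ω) : Prop :=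
  ∃ Q : Points E Ω, ∀ (τ : Gal(Ω/K)) (σ : L.fixingSubgroup), (∀ x, j (σ.1 x) = τ (j x)) →
    Points.map E j (c.1 σ : Points E (SepClosure F)) = τ • Q - Q

/-- Inner automorphisms act trivially on cohomology: moving the embedding by `g` moves `Q` by the
value of `c` at `g`. -/
theorem LocallyTrivial.comp_galois {c : Z1 L.fixingSubgroup (torsion E r (SepClosure F))}
    {K : Type*} [Field K] [Algebra F K] {Ω : Type*} [Field Ω] [Algebra F Ω] [Algebra K Ω]
    [IsScalarTower F K Ω] {j j' : SepClosure F →ₐ[F] Ω} (h : LocallyTrivial c K j)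
    (g : L.fixingSubgroup) (hg : ∀ x, j' x = j (g.1 x)) : LocallyTrivial c K j' := by
  obtain ⟨Q, hQ⟩ := h
  refine ⟨Q + Points.map E j (c.1 g : Points E (SepClosure F)), fun τ σ hσ => ?_⟩
  have h1 : ∀ x, j ((g * σ * g⁻¹).1 x) = τ (j x) := fun x => by
    have h2 := hσ (g.1⁻¹ x)
    rw [hg, hg] at h2
    change j (g.1 (σ.1 (g.1⁻¹ x))) = _
    rw [h2]
    exact congrArg (fun y => τ (j y)) (g.1.apply_symm_apply x)
  have h3 := hQ τ _ h1
  have h4 : c.1 g + g • c.1 σ = c.1 (g * σ * g⁻¹) + (g * σ * g⁻¹) • c.1 g := by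
    rw [← c.2.2, ← c.2.2, inv_mul_cancel_right]
  have h5 : (c.1 g : Points E (SepClosure F)) + g.1 • (c.1 σ : Points E (SepClosure F)) =
    (c.1 (g * σ * g⁻¹) : Points E (SepClosure F)) +
      (g * σ * g⁻¹).1 • (c.1 g : Points E (SepClosure F)) := congrArg Subtype.val h4
  have h6 : Points.map E j' (c.1 σ : Points E (SepClosure F)) =
      Points.map E j (g.1 • (c.1 σ : Points E (SepClosure F))) := by
    change _ = Points.map E j (Points.map E _ _)
    rw [Points.map_map]
    congr 2
    exact AlgHom.ext hg
  rw [← eq_sub_iff_add_eq'] at h5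
  rw [h6, h5, map_sub, map_add, h3, Points.map_smul j h1, smul_add]
  abel

theorem LocallyTrivial.baseChange {c : Z1 L.fixingSubgroup (torsion E r (SepClosure F))}
    {K M Ω Ω' : Type*} [Field K] [Field M] [Field Ω] [Field Ω'] [Algebra F K] [Algebra F Ω]
    [Algebra K Ω] [IsScalarTower F K Ω] [Normal K Ω] [Algebra F M] [Algebra F Ω'] [Algebra M Ω']
    [IsScalarTower F M Ω'] {j : SepClosure F →ₐ[F] Ω} (h : LocallyTrivial c K j) (f : K →+* M)
    (ι : Ω →ₐ[F] Ω') (hι : ∀ x, ι (algebraMap K Ω x) = algebraMap M Ω' (f x)) :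
    LocallyTrivial c M (ι.comp j) := by
  obtain ⟨Q, hQ⟩ := h
  refine ⟨Points.map E ι Q, fun τ σ hσ => ?_⟩
  obtain ⟨τ', hτ'⟩ := exists_algEquiv_restrict f (ι : Ω →+* Ω') hι τ
  have h1 : ∀ x, j (σ.1 x) = τ' (j x) := fun x =>
    ι.injective ((hσ x).trans (hτ' (j x)).symm)
  rw [← Points.map_map, hQ τ' σ h1, map_sub, Points.map_smul ι hτ']

theorem restrictGal_mem_fixingSubgroup {K Ω : Type*} [Field K] [Field Ω] [Algebra F K]
    [Algebra F Ω] [Algebra K Ω] [IsScalarTower F K Ω] (j : SepClosure F →ₐ[F] Ω)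
    (hj : ∀ x ∈ L, j x ∈ Set.range (algebraMap K Ω)) (τ : Gal(Ω/K)) :
    restrictGal j τ ∈ L.fixingSubgroup := by
  rw [IntermediateField.mem_fixingSubgroup_iff]
  intro x hx
  apply j.injective
  obtain ⟨y, hy⟩ := hj x hx
  refine (restrictGal_commutes j τ x).trans ?_
  change τ (j x) = j x
  rw [← hy]
  exact τ.commutes y

/-- Restriction of cocycles to a smaller Galois group. -/
def resCocycle (h : L ≤ L') (c : Z1 L.fixingSubgroup (torsion E r (SepClosure F))) :
    Z1 L'.fixingSubgroup (torsion E r (SepClosure F)) :=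
  Z1.map (Subgroup.inclusion (IntermediateField.fixingSubgroup_le h)) (continuous_inclusion
      (SetLike.coe_subset_coe.mpr (IntermediateField.fixingSubgroup_le h)))
    (AddMonoidHom.id _) (fun _ _ => rfl) c

theorem LocallyTrivial.res {c : Z1 L.fixingSubgroup (torsion E r (SepClosure F))}
    {K Ω : Type*} [Field K] [Field Ω] [Algebra F K] [Algebra F Ω] [Algebra K Ω]
    [IsScalarTower F K Ω] {j : SepClosure F →ₐ[F] Ω} (hc : LocallyTrivial c K j) (h : L ≤ L') :
    LocallyTrivial (resCocycle h c) K j := by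
  obtain ⟨Q, hQ⟩ := hc
  exact ⟨Q, fun τ σ hσ => hQ τ (Subgroup.inclusion (IntermediateField.fixingSubgroup_le h) σ) hσ⟩

/-- The descent from the completion `M` of `L'` to the completion `K` of `L`: a trivialising point
over `Ω'` is replaced by one over `F^sep`, valid on the subgroup fixing `L'`, and the pro-`l`
quotient is then averaged away. -/
theorem LocallyTrivial.of_res (h : L ≤ L') [IsGalois F L'] {l : ℕ} [Fact l.Prime]
    (hr : r ≠ 0) (hlr : l.Coprime r)
    (hΓ : ∀ γ : Gal(L'/F), Filter.Tendsto (fun s : ℕ => γ ^ l ^ s) Filter.atTop (𝓝 1))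
    [E.IsElliptic] [Infinite (SepClosure F)] {K M Ω Ω' : Type*} [Field K]
    [NontriviallyNormedField M] [CompleteSpace M] [IsUltrametricDist M] [Field Ω] [Field Ω']
    [Algebra F K] [Algebra F Ω] [Algebra K Ω] [IsScalarTower F K Ω] [IsGalois K Ω] [Algebra F M]
    [Algebra F Ω'] [Algebra M Ω'] [IsScalarTower F M Ω'] [IsGalois M Ω'] (hrM : (r : M) ≠ 0)
    (f : K →+* M) (hf : IsComplete (Set.range f)) (hf' : ∃ x, 1 < ‖f x‖)
    (ι : Ω →ₐ[F] Ω') (hι : ∀ x, ι (algebraMap K Ω x) = algebraMap M Ω' (f x))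
    (j : SepClosure F →ₐ[F] Ω) (hj : ∀ x ∈ L, j x ∈ Set.range (algebraMap K Ω))
    (e : L' → M) (he : DenseRange e) (hje : ∀ x : L', ι (j x) = algebraMap M Ω' (e x))
    {c : Z1 L.fixingSubgroup (torsion E r (SepClosure F))}
    (hc : LocallyTrivial (resCocycle h c) M (ι.comp j)) : LocallyTrivial c K j := by
  obtain ⟨Q, hQ⟩ := hc
  have hQfix : ∃ k, ∀ τ : Gal(Ω'/M), τ • (r ^ k • Q) = r ^ k • Q := by
    have : CompactSpace L.fixingSubgroup :=
      isCompact_iff_compactSpace.mp (InfiniteGalois.fixingSubgroup_isClosed L).isCompact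
    obtain ⟨k, hk⟩ := exists_pow_smul_eq_zero (r := r) c.1 c.2.1 fun σ => by
      obtain ⟨k, hk⟩ := (c.1 σ).2
      exact ⟨k, Subtype.ext hk⟩
    refine ⟨k, fun τ => ?_⟩
    have h1 := hQ τ ⟨_, restrictGal_mem_fixingSubgroup (ι.comp j)
      (fun x hx => ⟨e ⟨x, hx⟩, (hje ⟨x, hx⟩).symm⟩) τ⟩ (restrictGal_commutes _ τ)
    have h2 := congrArg (fun P => r ^ k • P) h1
    simp only [smul_sub] at h2
    rw [← map_nsmul, ← AddSubgroup.coe_nsmul] at h2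
    rw [show r ^ k • (resCocycle h c).1 _ = 0 from hk _, ZeroMemClass.coe_zero, map_zero,
      eq_comm, sub_eq_zero] at h2
    rwa [smul_comm]
  obtain ⟨k, hk⟩ := hQfix
  obtain ⟨P, hP⟩ := exists_map_eq_of_fixed hk
  replace hP := hP.symm
  obtain ⟨Q₀, R, rfl⟩ := exists_eq_map_add_map (ι.comp j) (E := E) (n := r ^ k)
    (he.mono (by rintro _ ⟨x, rfl⟩; exact ⟨x, hje x⟩)) (by
      rw [Nat.cast_pow]; exact pow_ne_zero k hrM) hP
  let ρ : Gal(Ω/K) →* L.fixingSubgroup := (restrictGal j).codRestrict _ (restrictGal_mem_fixingSubgroup j hj)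
  have hρ : ∀ τ x, j ((ρ τ).1 x) = τ (j x) := restrictGal_commutes j
  have hρc : Continuous ρ := (continuous_restrictGal j).subtype_mk _
  let π : Gal(Ω/K) →* Gal(L'/F) := (AlgEquiv.restrictNormalHom L').comp (restrictGal j)
  have hπ : Continuous π :=
    (InfiniteGalois.restrictNormalHom_continuous L').comp (continuous_restrictGal j)
  let b : Gal(Ω/K) → Points E Ω := fun τ => Points.map E j (c.1 (ρ τ) : Points E (SepClosure F))
  have hb : IsLocallyConstant b := (c.2.1.comp_continuous hρc).comp
    fun m => Points.map E j (m : Points E (SepClosure F))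
  have hbc : ∀ σ τ, b (σ * τ) = b σ + σ • b τ := fun σ τ => by
    have h1 : (c.1 (ρ (σ * τ)) : Points E (SepClosure F)) =
        (c.1 (ρ σ) : Points E (SepClosure F)) + (ρ σ).1 • (c.1 (ρ τ) : Points E (SepClosure F)) := by
      rw [map_mul, c.2.2]
      rfl
    simp only [b]
    rw [h1, map_add, Points.map_smul j (hρ σ)]
  obtain ⟨k', hk'⟩ := exists_pow_smul_eq_zero (r := r) b hb fun τ => by
    obtain ⟨k', hk'⟩ := (c.1 (ρ τ)).2
    exact ⟨k', by simp only [b]; rw [← map_nsmul, hk', map_zero]⟩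
  have hker : ∀ τ ∈ π.ker, b τ = τ • Points.map E j Q₀ - Points.map E j Q₀ := by
    intro τ hτ
    have hfix : ∀ x : L', (ρ τ).1 x = x := fun x => by
      have h1 : (restrictGal j τ).restrictNormal L' = 1 := hτ
      have h2 := (restrictGal j τ).restrictNormal_commutes L' x
      rw [h1] at h2
      exact h2.symm
    -- Automorphisms over `K` are isometries, so one that fixes `L'` also fixes its limits in `M`:
    -- for `y` in `L'` close to `x`, the difference `ρ τ x - x` is `ρ τ (x - y) - (x - y)`.
    have hfix' : ∀ x, ι.comp j x ∈ Set.range (algebraMap M Ω') → (ρ τ).1 x = x := by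
      rintro x ⟨m, hm⟩
      have hz : spectralNorm M Ω' (ι (j ((ρ τ).1 x - x))) = 0 := by
        refine le_antisymm (le_of_forall_pos_le_add fun ε hε => ?_) (spectralNorm_nonneg _)
        obtain ⟨y, hy⟩ := he.exists_dist_lt m hε
        have h1 : ι (j (x - y)) = algebraMap M Ω' (m - e y) := by
          rw [map_sub, map_sub, hje, map_sub, hm]
          rfl
        have h2 : ι (j ((ρ τ).1 (x - y))) = ι (τ (j (x - y))) := by rw [hρ]
        have h3 : (ρ τ).1 x - x = (ρ τ).1 (x - y) + (- (x - y)) := by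
          rw [map_sub, hfix]
          ring
        rw [h3, map_add, map_add, zero_add]
        refine (isNonarchimedean_spectralNorm _ _).trans (max_le ?_ ?_)
        · rw [h2]
          refine (spectralNorm_galois_invariant f hf hf' (ι : Ω →+* Ω') hι τ _).trans_le ?_
          change spectralNorm M Ω' (ι (j (x - y))) ≤ ε
          rw [h1, spectralNorm_extends, ← dist_eq_norm]
          exact hy.le
        · rw [map_neg, map_neg, spectralNorm_neg (Algebra.IsAlgebraic.isAlgebraic _), h1,
            spectralNorm_extends, ← dist_eq_norm]
          exact hy.le
      have h0 := eq_zero_of_map_spectralNorm_eq_zero hz (Algebra.IsAlgebraic.isAlgebraic _)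
      rw [map_eq_zero, map_eq_zero] at h0
      exact sub_eq_zero.mp h0
    -- Thus `ρ τ` comes from some `τ'` over `M`, where the hypothesis on `Q = Q₀ + R` applies and
    -- the rational point `R` cancels.
    obtain ⟨τ', hτ'⟩ := exists_algEquiv_of_fixes (ι.comp j) (ρ τ).1 hfix'
    have h1 := hQ τ' ⟨(ρ τ).1, (IntermediateField.mem_fixingSubgroup_iff _ _).mpr
      fun x hx => hfix ⟨x, hx⟩⟩ hτ'
    apply Points.map_injective ι
    refine (Points.map_map E ι j _).trans (h1.trans ?_)
    rw [map_sub, ← Points.map_smul j (hρ τ), Points.map_map, Points.map_map,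
      Points.map_smul _ hτ', smul_add, smul_map_base]
    abel
  obtain ⟨Q', hQ'⟩ := exists_coboundary_of_ker hr hlr hΓ π hπ
    (fun m => isLocallyConstant_smul m) b hb hbc hk' (Points.map E j Q₀) hker
  refine ⟨Q', fun τ σ hσ => ?_⟩
  have h1 : σ = ρ τ := Subtype.ext (AlgEquiv.ext fun x =>
    j.injective ((hσ x).trans (hρ τ x).symm))
  rw [h1]
  exact hQ' τ

end LocalConditions

/-! ### Comparison of the Selmer conditions at a place and at a place above it -/

section Comparison

open Topology

universe u

variable {F : Type u} [Field F] {E : WeierstrassCurve F} {r : ℕ}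
  {L L' : IntermediateField F (SepClosure F)}

/-- The comparison of local conditions for completions `K` of `L` and `M` of `L'`. -/
theorem locallyTrivial_resCocycle_iff_of_norm (h : L ≤ L') [IsGalois F L'] {l : ℕ} [Fact l.Prime]
    (hr : (r : F) ≠ 0) (hlr : l.Coprime r)
    (hΓ : ∀ γ : Gal(L'/F), Filter.Tendsto (fun s : ℕ => γ ^ l ^ s) Filter.atTop (𝓝 1))
    [E.IsElliptic] [Infinite (SepClosure F)] {K M : Type*} [fldK : Field K] [fldM : Field M]
    [Algebra F K] [Algebra F M] (NK : NontriviallyNormedField K)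
    (hNK : NK.toNormedField.toField = fldK) (NM : NontriviallyNormedField M)
    (hNM : NM.toNormedField.toField = fldM) [CompleteSpace K] [CompleteSpace M]
    [IsUltrametricDist M] (i : L →ₐ[F] K) (i' : L' →ₐ[F] M) (hi : DenseRange i)
    (hi' : DenseRange i')
    (hii' : ∀ x, ‖i x‖ < 1 ↔ ‖i' (IntermediateField.inclusion h x)‖ < 1)
    (j : SepClosure F →ₐ[F] SepClosure K) (hj : ∀ x : L, j x = algebraMap K _ (i x))
    (j' : SepClosure F →ₐ[F] SepClosure M) (hj' : ∀ x : L', j' x = algebraMap M _ (i' x))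
    (c : Z1 L.fixingSubgroup (torsion E r (SepClosure F))) :
    LocallyTrivial (resCocycle h c) M j' ↔ LocallyTrivial c K j := by
  subst hNK hNM
  obtain ⟨f, hf, hfu⟩ := exists_ringHom_extension (i : L →+* K)
    ((i' : L' →+* M).comp (IntermediateField.inclusion h : L →+* L')) hi hii'
  have hfF : ∀ x, f (algebraMap F K x) = algebraMap F M x := fun x => by
    have h1 := hf (algebraMap F L x)
    simpa using h1
  let f' : K →ₐ[F] M := { f with commutes' := hfF }
  obtain ⟨ι, hι⟩ := exists_lift_sepClosure f'
  -- The chosen embeddings `j'` and `ι ∘ j` need not be compatible. They agree on `L`, so they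
  -- differ by some `g` in the Galois group of `L`, which does not affect local triviality.
  obtain ⟨g, hg⟩ := exists_algEquiv_comp_eq j' (ι.comp j)
  have hιj : ∀ x : L, ι (j x) = j' x := fun x => by
    rw [hj, hι]
    refine Eq.trans ?_ (hj' (IntermediateField.inclusion h x)).symm
    exact congrArg _ (hf x)
  have hgL : g ∈ L.fixingSubgroup := by
    rw [IntermediateField.mem_fixingSubgroup_iff]
    intro x hx
    exact (ι.comp j).injective ((hg x).symm.trans (hιj ⟨x, hx⟩).symm)
  let g' : L.fixingSubgroup := ⟨g, hgL⟩
  let k : SepClosure F →ₐ[F] SepClosure K := j.comp g.toAlgHom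
  have hk : j' = ι.comp k := AlgHom.ext hg
  have hkj : LocallyTrivial c K k ↔ LocallyTrivial c K j := by
    refine ⟨fun h => h.comp_galois g'⁻¹ fun x => ?_, fun h => h.comp_galois g' fun x => rfl⟩
    exact congrArg j (g.apply_symm_apply x).symm
  rw [← hkj, hk]
  constructor
  · intro hc
    have hr0 : r ≠ 0 := by
      rintro rfl
      exact hr Nat.cast_zero
    have hrM : (r : M) ≠ 0 := by
      rw [← map_natCast (algebraMap F M)]
      exact (map_ne_zero _).mpr hr
    obtain ⟨x, hx⟩ := NormedField.exists_one_lt_norm K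
    refine LocallyTrivial.of_res h hr0 hlr hΓ hrM (f : K →+* M) hfu.isComplete_range ?_ ι hι k ?_ i'
      hi' ?_ hc
    · obtain ⟨a, ha⟩ := hi.exists_mem_open (isOpen_lt continuous_const continuous_norm) ⟨x, hx⟩
      have ha0 : a ≠ 0 := by
        rintro rfl
        rw [Set.mem_ofPred_eq, map_zero, norm_zero] at ha
        exact not_lt.mpr zero_le_one ha
      have h1 := (hii' a⁻¹).mp (by
        rw [map_inv₀, norm_inv]
        exact inv_lt_one_of_one_lt₀ ha)
      rw [map_inv₀, map_inv₀, norm_inv, inv_lt_one₀ (by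
        rw [norm_pos_iff, map_ne_zero, map_ne_zero]
        exact ha0)] at h1
      refine ⟨i a, ?_⟩
      have h2 := hf a
      change f (i a) = _ at h2
      rw [h2]
      exact h1
    · intro x hx
      refine ⟨i ⟨x, hx⟩, ?_⟩
      rw [← hj]
      exact congrArg j ((IntermediateField.mem_fixingSubgroup_iff _ _).mp hgL x hx).symm
    · intro x
      rw [← hj', hk]
      rfl
  · intro hc
    exact (hc.baseChange (f : K →+* M) ι hι).res h

theorem mk_mem_selmer_iff (c : Z1 L.fixingSubgroup (torsion E r (SepClosure F))) :
    H1.mk c ∈ selmer E r L ↔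
      ∀ v : Place L, LocallyTrivial c v.Completion (sepEmbedding v) := by
  have h1 : H1.mk c ∈ selmer E r L ↔
      ∀ v : Place L, localisation E r v (H1.mk c) ∈ kummerImage E r v.Completion := by
    rw [selmer, AddMonoidHom.mem_ker, funext_iff]
    exact forall_congr' fun v => QuotientAddGroup.eq_zero_iff _
  rw [h1]
  refine forall_congr' fun v => (mk_mem_kummerImage_iff _).trans (exists_congr fun Q => ?_)
  constructor
  · intro h τ σ hσ
    have h2 : σ = decomposition v τ := Subtype.ext (AlgEquiv.ext fun x =>
      (sepEmbedding v).injective ((hσ x).trans (restrictGal_commutes (sepEmbedding v) τ x).symm))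
    rw [h2]
    exact h τ
  · intro h τ
    exact h τ (decomposition v τ) (restrictGal_commutes (sepEmbedding v) τ)

theorem locallyTrivial_resCocycle_iff (h : L ≤ L') [IsGalois F L'] {l : ℕ} [Fact l.Prime]
    (hr : (r : F) ≠ 0) (hlr : l.Coprime r)
    (hΓ : ∀ γ : Gal(L'/F), Filter.Tendsto (fun s : ℕ => γ ^ l ^ s) Filter.atTop (𝓝 1))
    [E.IsElliptic] [Infinite (SepClosure F)] (v : Place L) (w : Place L')
    [MulArchimedean v.1.ValueGroup] [MulArchimedean w.1.ValueGroup]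
    (hvw : w.1.comap (IntermediateField.inclusion h : L →+* L') = v.1)
    (c : Z1 L.fixingSubgroup (torsion E r (SepClosure F))) :
    LocallyTrivial (resCocycle h c) w.Completion (sepEmbedding w) ↔
      LocallyTrivial c v.Completion (sepEmbedding v) := by
  obtain ⟨NK, hNK, hcK, -, hdK, hnK⟩ := v.exists_normedField
  obtain ⟨NM, hNM, hcM, huM, hdM, hnM⟩ := w.exists_normedField
  refine locallyTrivial_resCocycle_iff_of_norm h hr hlr hΓ NK hNK NM hNM
    (IsScalarTower.toAlgHom F L v.Completion) (IsScalarTower.toAlgHom F L' w.Completion) hdK hdM ?_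
    _ (sepEmbedding_coe v) _ (sepEmbedding_coe w) c
  intro x
  refine (hnK x).trans (Iff.trans ?_ (hnM _).symm)
  let _ : Algebra L L' := (IntermediateField.inclusion h : L →+* L').toAlgebra
  obtain ⟨O, hO⟩ := v
  obtain rfl : _ = O := hvw
  exact valuation_comap_lt_one_iff w.1 x

/-- Every place of `L` has a place of `L'` above it, and every place of `L'` lies above one of `L`,
so the placewise comparison covers both conditions. -/
theorem mk_resCocycle_mem_selmer_iff (h : L ≤ L') [IsGalois F L'] {l : ℕ} [Fact l.Prime]
    (hr : (r : F) ≠ 0) (hlr : l.Coprime r)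
    (hΓ : ∀ γ : Gal(L'/F), Filter.Tendsto (fun s : ℕ => γ ^ l ^ s) Filter.atTop (𝓝 1))
    [E.IsElliptic] [Infinite (SepClosure F)]
    (hL : ∀ O : ValuationSubring L, MulArchimedean O.ValueGroup)
    (hL' : ∀ O : ValuationSubring L', MulArchimedean O.ValueGroup)
    (c : Z1 L.fixingSubgroup (torsion E r (SepClosure F))) :
    H1.mk (resCocycle h c) ∈ selmer E r L' ↔ H1.mk c ∈ selmer E r L := by
  rw [mk_mem_selmer_iff, mk_mem_selmer_iff]
  let _ : Algebra L L' := (IntermediateField.inclusion h : L →+* L').toAlgebra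
  have _ : IsScalarTower F L L' := IsScalarTower.of_algebraMap_eq fun _ => rfl
  have _ : Algebra.IsAlgebraic L L' := Algebra.IsAlgebraic.tower_top (K := F) L
  constructor
  · intro hc v
    obtain ⟨O, hO⟩ := exists_comap_eq (T := L') v.1
    have := hL v.1
    have := hL' O
    refine (locallyTrivial_resCocycle_iff h hr hlr hΓ v ⟨O, ?_⟩ hO c).mp (hc _)
    rintro rfl
    refine v.2 (hO.symm.trans (eq_top_iff.mpr fun x _ => ?_))
    exact ValuationSubring.mem_comap.mpr (ValuationSubring.mem_top _)
  · intro hc w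
    have := hL (w.1.comap (algebraMap L L'))
    have := hL' w.1
    exact (locallyTrivial_resCocycle_iff h hr hlr hΓ ⟨_, comap_ne_top w.2⟩ w rfl c).mpr (hc _)

end Comparison

/-! ### The control theorem -/

section Control

open Topology

theorem tendsto_pow_of_equiv_padicInt {Γ : Type*} [Group Γ] [TopologicalSpace Γ] {l d : ℕ}
    [Fact l.Prime] (e : Γ ≃ₜ* Multiplicative (Fin d → ℤ_[l])) (γ : Γ) :
    Filter.Tendsto (fun s : ℕ => γ ^ l ^ s) Filter.atTop (𝓝 1) := by
  let z : Fin d → ℤ_[l] := Multiplicative.toAdd (e γ)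
  have h1 : Filter.Tendsto (fun s : ℕ => l ^ s • z) Filter.atTop (𝓝 0) := by
    refine tendsto_pi_nhds.mpr fun i => ?_
    have h2 : Filter.Tendsto (fun s : ℕ => (l : ℤ_[l]) ^ s * z i) Filter.atTop (𝓝 (0 * z i)) :=
      (tendsto_pow_atTop_nhds_zero_of_norm_lt_one
        ((PadicInt.norm_lt_one_iff_dvd _).mpr dvd_rfl)).mul_const _
    simpa using h2
  have h3 : ∀ s : ℕ, γ ^ l ^ s = e.symm (Multiplicative.ofAdd (l ^ s • z)) := fun s => by
    rw [ofAdd_nsmul, map_pow]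
    exact congrArg (· ^ l ^ s) (e.symm_apply_apply γ).symm
  have h4 : Filter.Tendsto (fun s : ℕ => e.symm (Multiplicative.ofAdd (l ^ s • z))) Filter.atTop
      (𝓝 (e.symm (Multiplicative.ofAdd 0))) :=
    (e.symm.continuous.tendsto _).comp ((continuous_ofAdd.tendsto _).comp h1)
  simpa only [← h3, ofAdd_zero, map_one] using h4

theorem isIntegral_int_of_isAlgebraic_zmod (p : ℕ) [Fact p.Prime] {k : Type*} [Field k]
    [Algebra (ZMod p) k] [Algebra.IsAlgebraic (ZMod p) k] (x : k) : IsIntegral ℤ x := by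
  have : Algebra.IsIntegral ℤ (ZMod p) := ⟨fun y => by
    obtain ⟨m, rfl⟩ := ZMod.intCast_surjective y
    exact isIntegral_algebraMap (R := ℤ) (x := m)⟩
  exact isIntegral_trans (R := ℤ) (A := ZMod p) x (Algebra.IsAlgebraic.isAlgebraic x).isIntegral

theorem infinite_of_functionField (k F : Type*) [Field k] [Field F] [Algebra (RatFunc k) F] :
    Infinite F :=
  Infinite.of_injective ((algebraMap (RatFunc k) F).comp (algebraMap (Polynomial k) (RatFunc k)))
    ((algebraMap (RatFunc k) F).injective.comp
      (IsFractionRing.injective (Polynomial k) (RatFunc k)))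

universe u

variable {F : Type u} [Field F] {E : WeierstrassCurve F} {r : ℕ}
  {ℱ : IntermediateField F (SepClosure F)} {K : IntermediateField F ℱ}

theorem liftNormal_mem_fixingSubgroup [Normal F ℱ] {γ : Gal(ℱ/F)} (hγ : γ ∈ K.fixingSubgroup) :
    γ.liftNormal (SepClosure F) ∈ (IntermediateField.lift K).fixingSubgroup := by
  rw [IntermediateField.mem_fixingSubgroup_iff]
  intro x hx
  have h1 : x ∈ ℱ := IntermediateField.lift_le K hx
  have h2 := (IntermediateField.mem_lift (⟨x, h1⟩ : ℱ)).mp hx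
  refine (γ.liftNormal_commutes (SepClosure F) ⟨x, h1⟩).trans ?_
  exact congrArg Subtype.val ((IntermediateField.mem_fixingSubgroup_iff _ _).mp hγ _ h2)

variable [IsGalois F ℱ]

theorem restrictNormal_mem_fixingSubgroup {g : Gal(SepClosure F/F)}
    (hg : g ∈ (IntermediateField.lift K).fixingSubgroup) :
    g.restrictNormal ℱ ∈ K.fixingSubgroup := by
  rw [IntermediateField.mem_fixingSubgroup_iff]
  intro x hx
  refine Subtype.ext ((g.restrictNormal_commutes ℱ x).trans ?_)
  exact (IntermediateField.mem_fixingSubgroup_iff _ _).mp hg _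
    ((IntermediateField.mem_lift x).mpr hx)

theorem galAct_restriction {γ : Gal(ℱ/F)} (hγ : γ ∈ K.fixingSubgroup)
    (x : globalH1 E r (IntermediateField.lift K)) :
    galAct E r ℱ γ (restriction E r (IntermediateField.lift_le K) x) =
      restriction E r (IntermediateField.lift_le K) x := by
  obtain ⟨c, rfl⟩ := H1.exists_mk x
  let g : (IntermediateField.lift K).fixingSubgroup := ⟨_, liftNormal_mem_fixingSubgroup hγ⟩
  -- Conjugation by `g` changes `c` by the coboundary of the value of `c` at `g`, which is defined
  -- since `g` fixes `K`.
  refine (H1.mk_eq_mk_iff.mpr ⟨c.1 g, fun σ => ?_⟩ : H1.mk (resCocycle (IntermediateField.lift_le K) c) = _).symm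
  let σ' : (IntermediateField.lift K).fixingSubgroup :=
    Subgroup.inclusion (IntermediateField.fixingSubgroup_le (IntermediateField.lift_le K)) σ
  change g • c.1 (g⁻¹ * σ' * g⁻¹⁻¹) = c.1 σ' + (σ' • c.1 g - c.1 g)
  have h1 := c.2.2 g (g⁻¹ * σ' * g⁻¹⁻¹)
  rw [← add_sub_assoc, ← c.2.2, eq_sub_iff_add_eq', ← h1]
  group

variable (K) in
/-- The restriction homomorphism from the Galois group over `K` to the Galois group of `ℱ`. -/
def restrictHom : (IntermediateField.lift K).fixingSubgroup →* Gal(ℱ/F) :=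
  (AlgEquiv.restrictNormalHom ℱ).comp (Subgroup.subtype _)

theorem continuous_restrictHom : Continuous (restrictHom K) :=
  (InfiniteGalois.restrictNormalHom_continuous ℱ).comp continuous_subtype_val

theorem mem_ker_restrictHom {σ : (IntermediateField.lift K).fixingSubgroup} :
    σ ∈ (restrictHom K).ker ↔ σ.1 ∈ ℱ.fixingSubgroup := by
  rw [IntermediateField.mem_fixingSubgroup_iff, MonoidHom.mem_ker]
  constructor
  · intro h x hx
    have h1 : σ.1.restrictNormal ℱ = 1 := h
    have h2 := σ.1.restrictNormal_commutes ℱ ⟨x, hx⟩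
    rw [h1] at h2
    exact h2.symm
  · intro h
    refine AlgEquiv.ext fun x => Subtype.ext ?_
    exact (σ.1.restrictNormal_commutes ℱ x).trans (h x x.2)

instance (L : IntermediateField F (SepClosure F)) : CompactSpace L.fixingSubgroup :=
  isCompact_iff_compactSpace.mp (InfiniteGalois.fixingSubgroup_isClosed L).isCompact

theorem isLocallyConstant_smul_fixingSubgroup {L : IntermediateField F (SepClosure F)}
    (m : torsion E r (SepClosure F)) : IsLocallyConstant fun σ : L.fixingSubgroup => σ • m :=
  (isLocallyConstant_smul_torsion (K := F) m).comp_continuous continuous_subtype_val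

variable {l : ℕ} [Fact l.Prime]

theorem restriction_injective (hr : r ≠ 0) (hlr : l.Coprime r)
    (hΓ : ∀ γ : Gal(ℱ/F), Filter.Tendsto (fun s : ℕ => γ ^ l ^ s) Filter.atTop (𝓝 1)) :
    Function.Injective (restriction E r (IntermediateField.lift_le K)) := by
  rw [injective_iff_map_eq_zero]
  intro x hx
  obtain ⟨c, rfl⟩ := H1.exists_mk x
  obtain ⟨m, hm⟩ := H1.mk_eq_mk_iff.mp ((map_zero H1.mk).trans hx.symm)
  obtain ⟨k, hk⟩ := exists_pow_smul_eq_zero (r := r) c.1 c.2.1 fun σ => by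
    obtain ⟨k, hk⟩ := (c.1 σ).2
    exact ⟨k, Subtype.ext hk⟩
  obtain ⟨m', hm'⟩ := exists_coboundary_of_ker hr hlr hΓ (restrictHom K) continuous_restrictHom
    isLocallyConstant_smul_fixingSubgroup c.1 c.2.1 c.2.2 hk m fun σ hσ =>
      (hm ⟨σ.1, mem_ker_restrictHom.mp hσ⟩).trans (zero_add _)
  rw [← map_zero H1.mk, eq_comm, H1.mk_eq_mk_iff]
  exact ⟨m', fun σ => (hm' σ).trans (zero_add _).symm⟩

theorem exists_restriction_eq (hr : r ≠ 0) (hlr : l.Coprime r)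
    (hΓ : ∀ γ : Gal(ℱ/F), Filter.Tendsto (fun s : ℕ => γ ^ l ^ s) Filter.atTop (𝓝 1))
    {x : globalH1 E r ℱ} (hx : ∀ γ ∈ K.fixingSubgroup, galAct E r ℱ γ x = x) :
    ∃ y, restriction E r (IntermediateField.lift_le K) y = x := by
  classical
  obtain ⟨c, rfl⟩ := H1.exists_mk x
  -- The extension of `c` by zero; only its values on the kernel of `restrictHom K` enter.
  let c₁ : (IntermediateField.lift K).fixingSubgroup → torsion E r (SepClosure F) := fun σ =>
    if h : σ.1 ∈ ℱ.fixingSubgroup then c.1 ⟨σ.1, h⟩ else 0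
  have hc₁ : ∀ (σ : (IntermediateField.lift K).fixingSubgroup) (h : σ.1 ∈ ℱ.fixingSubgroup),
      c₁ σ = c.1 ⟨σ.1, h⟩ := fun σ h => dif_pos h
  have hmem : ∀ σ : (restrictHom K).ker, σ.1.1 ∈ ℱ.fixingSubgroup := fun σ =>
    mem_ker_restrictHom.mp σ.2
  obtain ⟨c', hc', hcoc, m, hm⟩ := exists_cocycle_of_invariant hr hlr hΓ (restrictHom K)
    continuous_restrictHom isLocallyConstant_smul_fixingSubgroup c₁ (by
      have h1 : Continuous fun σ : (restrictHom K).ker =>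
          (⟨σ.1.1, hmem σ⟩ : ℱ.fixingSubgroup) :=
        (continuous_subtype_val.comp continuous_subtype_val).subtype_mk _
      have h2 := c.2.1.comp_continuous h1
      have h3 : (fun σ : (restrictHom K).ker => c₁ σ) =
        c.1 ∘ fun σ : (restrictHom K).ker => (⟨σ.1.1, hmem σ⟩ : ℱ.fixingSubgroup) :=
          funext fun σ => hc₁ σ.1 (hmem σ)
      rwa [h3]) (by
      intro σ hσ τ hτ
      have hσ' := mem_ker_restrictHom.mp hσ
      have hτ' := mem_ker_restrictHom.mp hτ
      rw [hc₁ σ hσ', hc₁ τ hτ', hc₁ (σ * τ) (mul_mem hσ' hτ')]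
      exact c.2.2 ⟨σ.1, hσ'⟩ ⟨τ.1, hτ'⟩) (by
      intro σ
      obtain ⟨k, hk⟩ := (c₁ σ).2
      exact ⟨k, Subtype.ext hk⟩) (by
      intro g
      have h1 := hx _ (restrictNormal_mem_fixingSubgroup g.2)
      rw [galAct_restrictNormal] at h1
      obtain ⟨m, hm⟩ := H1.mk_eq_mk_iff.mp h1.symm
      refine ⟨m, fun σ hσ => ?_⟩
      have hσ' := mem_ker_restrictHom.mp hσ
      have h2 : (g⁻¹ * σ * g).1 ∈ ℱ.fixingSubgroup := by
        rw [← mem_ker_restrictHom]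
        simpa using (inferInstance : (restrictHom K).ker.Normal).conj_mem σ hσ g⁻¹
      have h3 := hm ⟨σ.1, hσ'⟩
      rw [hc₁ σ hσ', hc₁ _ h2]
      refine Eq.trans ?_ h3
      refine congrArg (fun τ => g.1 • c.1 τ) (Subtype.ext ?_)
      change g.1⁻¹ * σ.1 * g.1 = g.1⁻¹ * σ.1 * g.1⁻¹⁻¹
      rw [inv_inv])
  refine ⟨H1.mk ⟨c', hc', hcoc⟩, ?_⟩
  refine (H1.mk_eq_mk_iff.mpr ⟨m, fun σ => ?_⟩ :
    H1.mk c = H1.mk (resCocycle (IntermediateField.lift_le K) ⟨c', hc', hcoc⟩)).symm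
  let σ' : (IntermediateField.lift K).fixingSubgroup :=
    Subgroup.inclusion (IntermediateField.fixingSubgroup_le (IntermediateField.lift_le K)) σ
  have h1 := hm σ' (mem_ker_restrictHom.mpr σ.2)
  rw [hc₁ σ' σ.2] at h1
  exact h1

end Control

end SelmerControl
end
-- The isomorphism on Selmer groups.
open SelmerControl in
theorem mainTheorem6
    (p l r d : ℕ) [Fact p.Prime] [Fact l.Prime] [Fact r.Prime]
    (hlp : l ≠ p) (hrl : r ≠ l) (hrp : r ≠ p)
    -- the function field `F` with constant field `𝔽`, an algebraic extension of `𝔽_p`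
    (𝔽 : Type*) [Field 𝔽] [Algebra (ZMod p) 𝔽] [Algebra.IsAlgebraic (ZMod p) 𝔽]
    (F : Type*) [Field F] [Algebra 𝔽 F] [Algebra (RatFunc 𝔽) F] [IsScalarTower 𝔽 (RatFunc 𝔽) F]
    [FunctionField 𝔽 F]
    (hconst : ∀ x : F, IsAlgebraic 𝔽 x → x ∈ Set.range (algebraMap 𝔽 F))
    -- the elliptic curve
    (E : WeierstrassCurve F) [E.IsElliptic] (hj : E.j ∉ Set.range (algebraMap 𝔽 F))
    (hred : GoodOrSplitMultiplicative E)
    -- the `ℤ_l^d`-extension `ℱ` of `F`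
    (ℱ : IntermediateField F (SepClosure F)) [IsGalois F ℱ]
    (hΓ : Nonempty (Gal(ℱ/F) ≃ₜ* Multiplicative (Fin d → ℤ_[l])))
    -- the tower of finite extensions `F_n` with union `ℱ`
    (Fn : ℕ → IntermediateField F ℱ) (hfin : ∀ n, FiniteDimensional F (Fn n))
    (hmono : Monotone Fn) (hunion : ⨆ n, Fn n = ⊤) (n : ℕ) :
    ∃ φ : selmer E r (IntermediateField.lift (Fn n)) ≃+
        selmerInvariants E r ℱ (Fn n).fixingSubgroup,
      ∀ s, (φ s : globalH1 E r ℱ) =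
        restriction E r (IntermediateField.lift_le (Fn n)) s := by
  obtain ⟨e⟩ := hΓ
  have hpow := tendsto_pow_of_equiv_padicInt e
  have hr0 : r ≠ 0 := (Fact.out : r.Prime).ne_zero
  have hlr : l.Coprime r := (Nat.coprime_primes Fact.out Fact.out).mpr hrl.symm
  have hrF : (r : F) ≠ 0 := by
    have : CharP 𝔽 p := charP_of_injective_algebraMap (algebraMap (ZMod p) 𝔽).injective p
    have : CharP F p := charP_of_injective_algebraMap (algebraMap 𝔽 F).injective p
    rw [ne_eq, CharP.cast_eq_zero_iff F p, Nat.prime_dvd_prime_iff_eq Fact.out Fact.out]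
    exact hrp.symm
  have : Infinite F := infinite_of_functionField 𝔽 F
  have : Infinite (SepClosure F) :=
    Infinite.of_injective _ (algebraMap F (SepClosure F)).injective
  -- Every intermediate field is algebraic over `F`, so this covers the places of F_n and of `ℱ` at
  -- once.
  have harch : ∀ (L : IntermediateField F (SepClosure F)) (O : ValuationSubring L),
      MulArchimedean O.ValueGroup := fun L O => by
    let _ : Algebra 𝔽 L := ((algebraMap F L).comp (algebraMap 𝔽 F)).toAlgebra
    have _ : IsScalarTower 𝔽 F L := IsScalarTower.of_algebraMap_eq fun _ => rfl
    exact mulArchimedean_valueGroup (k := 𝔽) (isIntegral_int_of_isAlgebraic_zmod p)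
      (isAlgebraic_adjoin_of_transcendental (F := F)) O
  -- The Selmer conditions correspond in both directions: one makes the map well defined, the other
  -- makes it surjective.
  have hsel : ∀ x, restriction E r (IntermediateField.lift_le (Fn n)) x ∈ selmer E r ℱ ↔
      x ∈ selmer E r (IntermediateField.lift (Fn n)) := fun x => by
    obtain ⟨c, rfl⟩ := H1.exists_mk x
    exact mk_resCocycle_mem_selmer_iff (IntermediateField.lift_le (Fn n)) hrF hlr hpow (harch _) (harch _) c
  let f : selmer E r (IntermediateField.lift (Fn n)) →+
      selmerInvariants E r ℱ (Fn n).fixingSubgroup :=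
    ((restriction E r (IntermediateField.lift_le (Fn n))).comp (AddSubgroup.subtype _)).codRestrict
      _ fun s => ⟨(hsel s).mpr s.2, fun γ hγ => galAct_restriction hγ s.1⟩
  refine ⟨AddEquiv.ofBijective f ⟨fun a b hab => ?_, fun y => ?_⟩, fun s => rfl⟩
  · exact Subtype.ext (restriction_injective hr0 hlr hpow (congrArg Subtype.val hab))
  · obtain ⟨x, hx⟩ := exists_restriction_eq hr0 hlr hpow y.2.2
    exact ⟨⟨x, (hsel x).mp (hx ▸ y.2.1)⟩, Subtype.ext hx⟩
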